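/- **Setting.** A stream $A=((a_1,w_1),\dots,(a_N,w_N))$ of labels $a_n\in[u]$ and weights $w_n\in[1,\beta]$, $\beta\ge 1$, is fixed in advance; each item arrives at one of $m$ sites, which communicate with a coordinator. Let $f_e(A)=\sum_{n:\,a_n=e}w_n$ and $W=\sum_n w_n$. **Protocol** (with parameter $s\in\mathbb N$, $s\ge1$). In round $j=0,1,2,\dots$ the threshold is $\tau_j=2^j$. When $(a_n,w_n)$ arrives at a site, the site draws an independent $r_n\sim\mathrm{Unif}(0,1)$, sets $\rho_n=w_n/r_n$, and sends $(a_n,w_n,\rho_n)$ to the coordinator if $\rho_n\ge\tau_j$. The coordinator puts a received triple into $Q_{j+1}$ if $\rho_n>2\tau_j$ and into $Q_j$ otherwise. As soon as $|Q_{j+1}|\ge s$, round $j$ ends: the coordinator broadcasts $\tau_{j+1}=2\tau_j$ to all $m$ sites ($m$ messages), discards $Q_j$, and moves the triples of $Q_{j+1}$ with $\rho>2\tau_{j+1}$ to $Q_{j+2}$ (if $Q_{j+2}$ then has at least $s$ elements, round $j+1$ ends at once as well, and so on). **Estimate.** When a query is made after $N$ items, in round $j$, let $S'=Q_j\cup Q_{j+1}$,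 let $\hat\rho$ be the smallest priority in $S'$, let $S$ be $S'$ without one item of priority $\hat\rho$, and set $f_e(S)=\sum_{(a,w,\rho)\in S,\ a=e}\max(w,\hat\rho)$. **Theorem.** There are absolute constants $C,c,K>0$ such that for all $m,u,N$, all $\beta\ge1$, all $s\ge1$ and all such streams: 1. If $\beta N\ge 2s$, then with probability at least $1-e^{-cs}$ the number of rounds is at most $C\log(\beta N/s)$, and with probability at least $1-e^{-cs}$ the total number of messages is at most $C\,(m+s)\log(\beta N/s)$. 2. Almost surely $|S'|\ge\min(s,N)$, and $|S|=|S'|-1$ (for $S'\neq\emptyset$); with probability at least $1-e^{-cs}$, $|S'|\le Cs$. 3. If $0<\varepsilon\le\frac12$, $s\ge K\,\frac1{\varepsilon^2}\log\frac1\varepsilon$ and $N\ge s$, then with probability at least $1-1/s$, $$|f_e(S)-f_e(A)|\le\varepsilon W\qquad\text{for all } e\in[u]\text{ simultaneously.}$$ In particular, with $s=\lceil K\varepsilon^{-2}\log(1/\varepsilon)\rceil$ the coordinator holds a sample of size $\Theta(\varepsilon^{-2}\log(1/\varepsilon))$ with this accuracy. -/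

import Mathlib

open MeasureTheory

noncomputable section

namespace PrioritySampling

/-- A stream tuple `(a, w)` arriving at one of `m` sites: label `a ∈ [u]`, weight `w`. -/
structure Item (m u : ℕ) where
  site : Fin m
  label : Fin u
  weight : ℝ

/-- The triple `(a, w, ρ)` that a site sends to the coordinator. -/
structure Triple (u : ℕ) where
  label : Fin u
  weight : ℝ
  priority : ℝ

/-- Global state of the protocol. In round `j` the coordinator's threshold is `τ_j = 2 ^ j`,
`lower` is the queue `Q_j`, `upper` is the queue `Q_{j+1}`; `threshold i` is the threshold stored
at site `i`; `messages` counts all messages sent so far (a broadcast to all `m` sites costs `m`). -/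
structure State (m u : ℕ) where
  round : ℕ
  threshold : Fin m → ℝ
  lower : List (Triple u)
  upper : List (Triple u)
  messages : ℕ

variable {m u : ℕ}

/-- The coordinator's threshold `τ_j`. -/
def tau (j : ℕ) : ℝ := 2 ^ j

/-- Initially the round is `0`, all thresholds are `1` and the queues are empty. -/
def init (m u : ℕ) : State m u where
  round := 0
  threshold := fun _ => 1
  lower := []
  upper := []
  messages := 0

/-- End of round `j`: `τ_{j+1} = 2 τ_j` is broadcast, `Q_j` is discarded, and the items of
`Q_{j+1}` with priority above `2 τ_{j+1}` are moved to `Q_{j+2}`. -/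
def endRound (σ : State m u) : State m u where
  round := σ.round + 1
  threshold := fun _ => tau (σ.round + 1)
  lower := σ.upper.filter fun x => ¬ 2 * tau (σ.round + 1) < x.priority
  upper := σ.upper.filter fun x => 2 * tau (σ.round + 1) < x.priority
  messages := σ.messages + m

/-- Rounds are ended, one after the other, as long as the upper queue holds at least `s` items
(for `s ≥ 1` this stops, because every priority is eventually below the threshold). -/
def endRounds (s : ℕ) (σ : State m u) : State m u :=
  endRound^[sInf {k : ℕ | (endRound^[k] σ).upper.length < s}] σ

/-- The coordinator puts a received triple into `Q_{j+1}` or `Q_j`. -/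
def enqueue (σ : State m u) (x : Triple u) : State m u :=
  if 2 * tau σ.round < x.priority then { σ with upper := x :: σ.upper }
  else { σ with lower := x :: σ.lower }

/-- Arrival of an item `p.1` whose site draws the random number `p.2`: the site computes the
priority `w / r` and, if this is at least its threshold, sends the triple (one message). -/
def step (s : ℕ) (σ : State m u) (p : Item m u × ℝ) : State m u :=
  let x : Triple u := ⟨p.1.label, p.1.weight, p.1.weight / p.2⟩
  if σ.threshold p.1.site ≤ x.priority then
    endRounds s (enqueue { σ with messages := σ.messages + 1 } x)
  else σ

/-- The state after the stream `A` of `N` items, if `r` are the random numbers drawn. -/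
def run (s : ℕ) {N : ℕ} (A : Fin N → Item m u) (r : Fin N → ℝ) : State m u :=
  (List.ofFn fun n => (A n, r n)).foldl (step s) (init m u)

/-- `S' = Q_j ∪ Q_{j+1}`, everything the coordinator holds. -/
def State.held (σ : State m u) : List (Triple u) := σ.lower ++ σ.upper

open Classical in
/-- The sample `S`: all of `S'` except for a single item of smallest priority. -/
def State.sample (σ : State m u) : List (Triple u) :=
  match σ.held.argmin Triple.priority with
  | none => []
  | some x => σ.held.erase x

/-- The smallest priority `ρ̂` in `S'` (`0` if `S'` is empty). -/
def State.minPriority (σ : State m u) : ℝ :=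
  match σ.held.argmin Triple.priority with
  | none => 0
  | some x => x.priority

/-- The estimate `f_e(S)`: the sum over the items of `S` with label `e` of the adjusted weights
`max w ρ̂`. -/
def State.estimate (σ : State m u) (e : Fin u) : ℝ :=
  ((σ.sample.filter fun x => x.label = e).map fun x => max x.weight σ.minPriority).sum

/-- The weighted frequency `f_e(A)`. -/
def freq {N : ℕ} (A : Fin N → Item m u) (e : Fin u) : ℝ :=
  ∑ n with (A n).label = e, (A n).weight

/-- The total weight `W` of the stream. -/
def totalWeight {N : ℕ} (A : Fin N → Item m u) : ℝ := ∑ n, (A n).weight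

/-- The law of `N` independent random numbers, each uniform on `(0, 1)`. -/
def uniformLaw (N : ℕ) : Measure (Fin N → ℝ) :=
  Measure.pi fun _ => volume.restrict (Set.Ioo (0 : ℝ) 1)

end PrioritySampling

end

/-! Off a null set no priority equals a threshold and no two priorities agree. There the protocol is
deterministic bookkeeping (`valid_run`): the queues are the list of all triples cut at `tau j` and
`2 * tau j`, and the round `j` is the least one with fewer than `s` priorities above `2 * tau j`
(`round_run`). Every claim thus concerns the number of priorities above a level `t`, a sum of
independent indicators with success probabilities `min 1 (w / t)`, to which Chernoff bounds apply
(`integral_exp_hits_le`).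

Rounds: at `t` of order `W / s` the mean count is a small fraction of `s`, so the round is unlikely
to pass that level. Sample size: at the last level where the mean is still at least `8 * s`, the
count lies between `s` and `32 * s`; the first bound forces the round to reach this level, the
second bounds what is held. Messages: a sent item joins the upper queue with conditional probability
at least `1 / 2`, and few items can join it per round. `potential` makes this precise: its
expectation is at most `1` because the current round depends only on the past
(`lintegral_potential_le`), and Markov's inequality bounds the number sent.

Accuracy: the estimate is `estimateAt` at the random level `ρ̂`. At a fixed level `t` it is
unbiased, since `min 1 (w / t) * max w t = w`, and only items lighter than `t` contribute error
(`sum_estimate_sub`). Two union bounds remove the randomness of `ρ̂` and the choice of label. The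
tail for one label is made proportional to its frequency (`sum_estimate_tail`), so the sum over
labels gives the factor `W` and not `u`. Levels are restricted to a geometric grid below `32 * W /
s`, where the tails sum like a geometric series (`grid_tail`); monotonicity handles the levels in
between (`abs_estimateAt_sub_le`). With fewer than `s` priorities above `32 * W / s`, the level `ρ̂`
cannot exceed it. -/

noncomputable section

namespace PrioritySampling

variable {m u : ℕ}

/-! ### The protocol as an invariant on lists -/

/-- The triple formed from an item and the random number drawn for it. -/
def toTriple (p : Item m u × ℝ) : Triple u := ⟨p.1.label, p.1.weight, p.1.weight / p.2⟩

lemma tau_pos (j : ℕ) : 0 < tau j := by unfold tau; positivity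

lemma tau_succ (j : ℕ) : tau (j + 1) = 2 * tau j := by unfold tau; ring

lemma tau_mono {i j : ℕ} (h : i ≤ j) : tau i ≤ tau j :=
  pow_le_pow_right₀ (by norm_num) h

/-- The queues of `σ` are cut out of the list `L` of all triples by the thresholds of its round. -/
structure Tracks (L : List (Triple u)) (σ : State m u) : Prop where
  threshold : σ.threshold = fun _ => tau σ.round
  lower : σ.lower = L.filter fun x => tau σ.round < x.priority ∧ ¬ 2 * tau σ.round < x.priority
  upper : σ.upper = L.filter fun x => 2 * tau σ.round < x.priority

/-- `σ` tracks `L`, its round is not over, and its previous round is. -/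
structure Valid (s : ℕ) (L : List (Triple u)) (σ : State m u) : Prop extends Tracks L σ where
  upper_lt : σ.upper.length < s
  round_le : σ.round = 0 ∨ s ≤ (L.filter fun x => tau σ.round < x.priority).length

/-- Thresholds only grow, so what is discarded would be cut by every later filter of `L` as well. -/
lemma Tracks.endRound {L : List (Triple u)} {σ : State m u} (h : Tracks L σ) :
    Tracks L (endRound σ) where
  threshold := rfl
  lower := by
    simp only [PrioritySampling.endRound, h.upper, List.filter_filter, tau_succ]
    congr 1; ext x
    simp [and_comm]
  upper := by
    have := tau_pos σ.round
    simp only [PrioritySampling.endRound, h.upper, List.filter_filter, tau_succ]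
    congr 1; ext x
    rw [Bool.eq_iff_iff]
    simp only [Bool.and_eq_true, decide_eq_true_eq]
    constructor
    · exact fun h => h.1
    · intro h; exact ⟨h, by linarith⟩

lemma Tracks.iterate {L : List (Triple u)} {σ : State m u} (h : Tracks L σ) (k : ℕ) :
    Tracks L (PrioritySampling.endRound^[k] σ) ∧
      (PrioritySampling.endRound^[k] σ).round = σ.round + k ∧
      (PrioritySampling.endRound^[k] σ).messages = σ.messages + m * k := by
  induction k with
  | zero => exact ⟨h, rfl, rfl⟩
  | succ k ih =>
    rw [Function.iterate_succ_apply']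
    refine ⟨ih.1.endRound, ?_, ?_⟩
    · show (PrioritySampling.endRound^[k] σ).round + 1 = _
      rw [ih.2.1]; ring
    · show (PrioritySampling.endRound^[k] σ).messages + m = _
      rw [ih.2.2]; ring

lemma exists_filter_eq_nil (L : List (Triple u)) :
    ∃ k, ∀ j, k ≤ j → (L.filter fun x => 2 * tau j < x.priority) = [] := by
  induction L with
  | nil => exact ⟨0, by simp⟩
  | cons x L ih =>
    obtain ⟨k, hk⟩ := ih
    obtain ⟨i, hi⟩ := pow_unbounded_of_one_lt x.priority (one_lt_two (α := ℝ))
    refine ⟨max k i, fun j hj => ?_⟩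
    have h1 : tau i ≤ tau j := tau_mono ((le_max_right _ _).trans hj)
    have h2 : x.priority < tau i := hi
    have h3 := tau_pos j
    rw [List.filter_cons_of_neg, hk j ((le_max_left _ _).trans hj)]
    simp only [decide_eq_true_eq, not_lt]
    linarith

lemma Tracks.endRounds {s : ℕ} (hs : 1 ≤ s) {L : List (Triple u)} {σ : State m u}
    (h : Tracks L σ)
    (hr : σ.round = 0 ∨ s ≤ (L.filter fun x => tau σ.round < x.priority).length) :
    Valid s L (endRounds s σ) ∧ ∃ k, (endRounds s σ).round = σ.round + k ∧
      (endRounds s σ).messages = σ.messages + m * k ∧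
      (k = 0 → (endRounds s σ).upper = σ.upper) := by
  set P : Set ℕ := {k : ℕ | (PrioritySampling.endRound^[k] σ).upper.length < s} with hP
  -- On an empty set `sInf` would return `0` and the round need not be over; termination rules this
  -- out.
  have hne : P.Nonempty := by
    obtain ⟨k, hk⟩ := exists_filter_eq_nil L
    refine ⟨k, ?_⟩
    rw [hP, Set.mem_ofPred_eq, (h.iterate k).1.upper, (h.iterate k).2.1, hk _ (by omega)]
    exact hs
  have hmem : (PrioritySampling.endRound^[sInf P] σ).upper.length < s := Nat.sInf_mem hne
  obtain ⟨h1, h2, h3⟩ := h.iterate (sInf P)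
  refine ⟨⟨h1, hmem, ?_⟩, sInf P, h2, h3, fun h0 => ?_⟩
  · show (PrioritySampling.endRound^[sInf P] σ).round = 0 ∨ s ≤ (L.filter fun x =>
      tau (PrioritySampling.endRound^[sInf P] σ).round < x.priority).length
    rw [h2]
    rcases Nat.eq_zero_or_eq_succ_pred (sInf P) with h0 | h0
    · rw [h0]; exact hr
    · right
      -- Minimality: one round earlier the upper queue still had at least `s` items, and its cut `2
      -- * tau` is the present `tau`.
      have : (sInf P).pred ∉ P := Nat.notMem_of_lt_sInf (by omega)
      rw [hP, Set.mem_ofPred_eq, not_lt, (h.iterate _).1.upper, (h.iterate _).2.1,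
        ← tau_succ] at this
      rw [h0]
      exact this
  · show (PrioritySampling.endRound^[sInf P] σ).upper = σ.upper
    rw [h0]; rfl

lemma Valid.step_of_lt {s : ℕ} {L : List (Triple u)} {σ : State m u}
    (h : Valid s L σ) (p : Item m u × ℝ) (hp : (toTriple p).priority < tau σ.round) :
    step s σ p = σ ∧ Valid s (toTriple p :: L) σ := by
  have h2 := tau_pos σ.round
  constructor
  · simp only [step, h.threshold]
    exact if_neg (not_le.2 hp)
  · have e1 : ¬ tau σ.round < (toTriple p).priority := by linarith
    have e2 : ¬ 2 * tau σ.round < (toTriple p).priority := by linarith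
    refine ⟨⟨h.threshold, ?_, ?_⟩, h.upper_lt, ?_⟩
    · rw [h.lower, List.filter_cons_of_neg (by simp [e1])]
    · rw [h.upper, List.filter_cons_of_neg (by simpa using e2)]
    · rw [List.filter_cons_of_neg (by simpa using e1)]; exact h.round_le

/-- The clauses about `messages` and about `k = 0` serve the message count in `potential_run`. -/
lemma Valid.step_of_gt {s : ℕ} (hs : 1 ≤ s) {L : List (Triple u)} {σ : State m u}
    (h : Valid s L σ) (p : Item m u × ℝ) (hp : tau σ.round < (toTriple p).priority) :
    Valid s (toTriple p :: L) (step s σ p) ∧ ∃ k, (step s σ p).round = σ.round + k ∧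
      (step s σ p).messages = σ.messages + 1 + m * k ∧
      (k = 0 → (step s σ p).upper.length =
        σ.upper.length + if 2 * tau σ.round < (toTriple p).priority then 1 else 0) := by
  have hstep : step s σ p =
      endRounds s (enqueue { σ with messages := σ.messages + 1 } (toTriple p)) := by
    simp only [step, h.threshold]
    exact if_pos hp.le
  rw [hstep]
  set σ' : State m u := enqueue { σ with messages := σ.messages + 1 } (toTriple p) with hσ'
  have hround : σ'.round = σ.round := by
    rw [hσ']; unfold enqueue; split_ifs <;> rfl
  have hmess : σ'.messages = σ.messages + 1 := by
    rw [hσ']; unfold enqueue; split_ifs <;> rfl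
  have hup : σ'.upper.length =
      σ.upper.length + if 2 * tau σ.round < (toTriple p).priority then 1 else 0 := by
    rw [hσ']; unfold enqueue; split_ifs <;> rfl
  have htr : Tracks (toTriple p :: L) σ' := by
    rw [hσ']
    by_cases h2 : 2 * tau σ.round < (toTriple p).priority
    · rw [enqueue, if_pos h2]
      refine ⟨h.threshold, ?_, ?_⟩
      · show σ.lower = _
        rw [List.filter_cons_of_neg (by simp [h2]), h.lower]
      · show toTriple p :: σ.upper = _
        rw [List.filter_cons_of_pos (by simpa using h2), h.upper]
    · rw [enqueue, if_neg h2]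
      refine ⟨h.threshold, ?_, ?_⟩
      · show toTriple p :: σ.lower = _
        rw [List.filter_cons_of_pos (by simp [h2, hp]), h.lower]
      · show σ.upper = _
        rw [List.filter_cons_of_neg (by simpa using h2), h.upper]
  have hr : σ'.round = 0 ∨
      s ≤ ((toTriple p :: L).filter fun x => tau σ'.round < x.priority).length := by
    rw [hround]
    refine h.round_le.imp_right fun h' => h'.trans ?_
    rw [List.filter_cons]
    split_ifs <;> simp
  obtain ⟨hv, k, h1, h2, h3⟩ := htr.endRounds hs hr
  exact ⟨hv, k, by rw [h1, hround], by rw [h2, hmess], fun hk => by rw [h3 hk, hup]⟩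

lemma valid_init {s : ℕ} (hs : 1 ≤ s) : Valid s [] (init m u) :=
  ⟨⟨by simp [init, tau], rfl, rfl⟩, hs, Or.inl rfl⟩

lemma Valid.step {s : ℕ} (hs : 1 ≤ s) {L : List (Triple u)} {σ : State m u}
    (h : Valid s L σ) (p : Item m u × ℝ) (hp : ∀ j, (toTriple p).priority ≠ tau j) :
    Valid s (toTriple p :: L) (step s σ p) := by
  rcases lt_or_gt_of_ne (hp σ.round) with h' | h'
  · have := h.step_of_lt p h'
    rw [this.1]; exact this.2
  · exact (h.step_of_gt hs p h').1

lemma valid_foldl {s : ℕ} (hs : 1 ≤ s) (l : List (Item m u × ℝ))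
    (hl : ∀ p ∈ l, ∀ j, (toTriple p).priority ≠ tau j) :
    Valid s (l.map toTriple).reverse (l.foldl (PrioritySampling.step s) (init m u)) := by
  induction l using List.reverseRecOn with
  | nil => exact valid_init hs
  | append_singleton l p ih =>
    have := (ih fun q hq => hl q (by simp [hq])).step hs p (hl p (by simp))
    simpa using this

/-! ### Round and held items as functions of the priorities -/

/-- The triples of a stream, the last one first. -/
def triples {N : ℕ} (A : Fin N → Item m u) (r : Fin N → ℝ) : List (Triple u) :=
  ((List.ofFn fun n => (A n, r n)).map toTriple).reverse

/-- The number of indices at which `ρ` exceeds `t`. -/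
def countAbove {N : ℕ} (ρ : Fin N → ℝ) (t : ℝ) : ℕ := (Finset.univ.filter fun n => t < ρ n).card

lemma countAbove_anti {N : ℕ} (ρ : Fin N → ℝ) {t t' : ℝ} (h : t ≤ t') :
    countAbove ρ t' ≤ countAbove ρ t := by
  unfold countAbove
  apply Finset.card_le_card
  intro n
  simp only [Finset.mem_filter, Finset.mem_univ, true_and]
  exact fun h' => h.trans_lt h'

lemma triples_eq {N : ℕ} (A : Fin N → Item m u) (r : Fin N → ℝ) :
    triples A r = ((List.finRange N).map fun n => toTriple (A n, r n)).reverse := by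
  rw [triples, List.ofFn_eq_map, List.map_map]; rfl

lemma length_filter_triples {N : ℕ} (A : Fin N → Item m u) (r : Fin N → ℝ) (t : ℝ) :
    ((triples A r).filter fun x => t < x.priority).length
      = countAbove (fun n => (A n).weight / r n) t := by
  rw [triples_eq, List.filter_reverse, List.length_reverse, List.filter_map, List.length_map,
    countAbove]
  rfl

/-- The round determined by a family of priorities. -/
def roundOf (s : ℕ) {N : ℕ} (ρ : Fin N → ℝ) : ℕ := sInf {j | countAbove ρ (2 * tau j) < s}

/-- Random numbers for which no priority meets a threshold and no two priorities agree. -/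
structure Generic {N : ℕ} (A : Fin N → Item m u) (r : Fin N → ℝ) : Prop where
  pos : ∀ n, 0 < r n
  lt_one : ∀ n, r n < 1
  ne_tau : ∀ n j, (A n).weight / r n ≠ tau j
  inj : Function.Injective fun n => (A n).weight / r n

lemma valid_run {s : ℕ} (hs : 1 ≤ s) {N : ℕ} (A : Fin N → Item m u) (r : Fin N → ℝ)
    (hr : Generic A r) : Valid s (triples A r) (run s A r) := by
  refine valid_foldl hs _ fun p hp j => ?_
  obtain ⟨n, rfl⟩ := (List.mem_ofFn' _ _).1 hp
  exact hr.ne_tau n j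

/-- The count is antitone in the level, so the two clauses `upper_lt` and `round_le` of `Valid`
single out the least admissible index. The round therefore depends on the priorities alone, which
gives its measurability and its independence of the next random number. -/
lemma round_run {s : ℕ} (hs : 1 ≤ s) {N : ℕ} (A : Fin N → Item m u) (r : Fin N → ℝ)
    (hr : Generic A r) : (run s A r).round = roundOf s fun n => (A n).weight / r n := by
  have h := valid_run hs A r hr
  have hmem : (run s A r).round ∈
      {j | countAbove (fun n => (A n).weight / r n) (2 * tau j) < s} := by
    rw [Set.mem_ofPred_eq, ← length_filter_triples, ← h.upper]
    exact h.upper_lt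
  refine le_antisymm (le_csInf ⟨_, hmem⟩ fun j hj => ?_) (Nat.sInf_le hmem)
  by_contra! hlt
  rcases h.round_le with h0 | h0
  · omega
  · rw [length_filter_triples] at h0
    have : 2 * tau j ≤ tau (run s A r).round := by rw [← tau_succ]; exact tau_mono hlt
    exact absurd (h0.trans (countAbove_anti _ this)) (not_le.2 hj)

lemma round_le_of_countAbove_lt {s : ℕ} (hs : 1 ≤ s) {N : ℕ} (A : Fin N → Item m u)
    (r : Fin N → ℝ) (hr : Generic A r) {i : ℕ}
    (hi : countAbove (fun n => (A n).weight / r n) (2 * tau i) < s) :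
    (run s A r).round ≤ i := by
  rw [round_run hs A r hr]
  exact Nat.sInf_le hi

lemma countAbove_run_lt {s : ℕ} (hs : 1 ≤ s) {N : ℕ} (A : Fin N → Item m u)
    (r : Fin N → ℝ) (hr : Generic A r) :
    countAbove (fun n => (A n).weight / r n) (2 * tau (run s A r).round) < s := by
  have h := valid_run hs A r hr
  rw [← length_filter_triples, ← h.upper]
  exact h.upper_lt

lemma held_perm {s : ℕ} (hs : 1 ≤ s) {N : ℕ} (A : Fin N → Item m u) (r : Fin N → ℝ)
    (hr : Generic A r) : (run s A r).held.Perm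
      ((triples A r).filter fun x => tau (run s A r).round < x.priority) := by
  have h := valid_run hs A r hr
  have h0 := tau_pos (run s A r).round
  rw [State.held, h.lower, h.upper]
  have key := List.filter_append_perm (fun x : Triple u => decide (¬ 2 * tau (run s A r).round < x.priority))
    ((triples A r).filter fun x => tau (run s A r).round < x.priority)
  refine List.Perm.trans (List.Perm.of_eq ?_) key
  rw [List.filter_filter, List.filter_filter]
  congr 2 <;> ext x
  · simp [and_comm]
  · rw [Bool.eq_iff_iff]
    simp only [decide_eq_true_eq, decide_not, Bool.not_not, Bool.and_eq_true]
    constructor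
    · intro h; exact ⟨h, by linarith⟩
    · exact fun h => h.1

lemma length_held {s : ℕ} (hs : 1 ≤ s) {N : ℕ} (A : Fin N → Item m u) (r : Fin N → ℝ)
    (hr : Generic A r) : (run s A r).held.length
      = countAbove (fun n => (A n).weight / r n) (tau (run s A r).round) := by
  rw [(held_perm hs A r hr).length_eq, length_filter_triples]

lemma min_le_length_held {s : ℕ} (hs : 1 ≤ s) {N : ℕ} (A : Fin N → Item m u) (r : Fin N → ℝ)
    (hr : Generic A r) (hw : ∀ n, 1 ≤ (A n).weight) : min s N ≤ (run s A r).held.length := by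
  have h := valid_run hs A r hr
  rw [length_held hs A r hr]
  rcases h.round_le with h0 | h0
  -- In round `0` everything is held: `1 ≤ w` and `r < 1` put every priority above `tau 0 = 1`.
  · rw [h0, countAbove, Finset.filter_true_of_mem]
    · simp
    · intro n _
      rw [tau, pow_zero, lt_div_iff₀ (hr.pos n)]
      linarith [hw n, hr.lt_one n]
  · rw [length_filter_triples] at h0
    exact (min_le_left _ _).trans h0

lemma length_sample (σ : State m u) : σ.sample.length = σ.held.length - 1 := by
  classical
  unfold State.sample
  split
  · next h => rw [List.argmin_eq_none] at h; simp [h]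
  · next x h => 
    rw [List.length_erase_of_mem (List.argmin_mem h)]

lemma countAbove_le {N : ℕ} (ρ : Fin N → ℝ) (t : ℝ) : countAbove ρ t ≤ N := by
  unfold countAbove
  exact (Finset.card_filter_le _ _).trans (by simp)

/-! ### The uniform law and generic random numbers -/

/-- The uniform law on `(0, 1)`. -/
def unitLaw : Measure ℝ := volume.restrict (Set.Ioo (0 : ℝ) 1)

instance : IsProbabilityMeasure unitLaw := ⟨by simp [unitLaw]⟩

lemma uniformLaw_eq (N : ℕ) : uniformLaw N = Measure.pi fun _ => unitLaw := rfl

instance (N : ℕ) : IsProbabilityMeasure (uniformLaw N) := by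
  rw [uniformLaw_eq]; infer_instance

lemma unitLaw_priority {w t : ℝ} (ht : 0 < t) :
    unitLaw {x | t < w / x} = ENNReal.ofReal (min 1 (w / t)) := by
  rw [unitLaw, Measure.restrict_apply (measurableSet_lt measurable_const (by fun_prop))]
  have : {x | t < w / x} ∩ Set.Ioo 0 1 = Set.Ioo 0 (min 1 (w / t)) := by
    ext x
    simp only [Set.mem_inter_iff, Set.mem_ofPred_eq, Set.mem_Ioo, lt_min_iff]
    constructor
    · rintro ⟨h1, h2, h3⟩
      exact ⟨h2, h3, (lt_div_comm₀ ht h2).1 h1⟩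
    · rintro ⟨h1, h2, h3⟩
      exact ⟨(lt_div_comm₀ ht h1).2 h3, h1, h2⟩
  rw [this, Real.volume_Ioo, sub_zero]

lemma unitLaw_real_priority {w t : ℝ} (hw : 0 < w) (ht : 0 < t) :
    unitLaw.real {x | t < w / x} = min 1 (w / t) := by
  rw [Measure.real, unitLaw_priority ht, ENNReal.toReal_ofReal]
  positivity

lemma ae_eval {N : ℕ} (n : Fin N) {p : ℝ → Prop} (h : ∀ᵐ x ∂unitLaw, p x) :
    ∀ᵐ r ∂uniformLaw N, p (r n) :=
  (Measure.tendsto_eval_ae_ae (μ := fun _ : Fin N => unitLaw) (i := n)).eventually h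

/-- Ties lie in the kernel of a nonzero linear form, which is Lebesgue-null. -/
lemma ae_priority_ne {N : ℕ} {w : Fin N → ℝ} (hw : ∀ n, 0 < w n) {n n' : Fin N} (h : n ≠ n') :
    ∀ᵐ r ∂uniformLaw N, r n * w n' - r n' * w n ≠ 0 := by
  have hle : uniformLaw N ≪ volume := by
    rw [uniformLaw, ← Measure.restrict_pi_pi]
    exact Measure.absolutelyContinuous_of_le Measure.restrict_le_self
  suffices h0 : ∀ᵐ r : Fin N → ℝ ∂volume, r n * w n' - r n' * w n ≠ 0 from hle.ae_le h0
  let φ : (Fin N → ℝ) →ₗ[ℝ] ℝ := w n' • LinearMap.proj n - w n • LinearMap.proj n'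
  have hφ : LinearMap.ker φ ≠ ⊤ := by
    intro htop
    have : Pi.single n 1 ∈ LinearMap.ker φ := htop ▸ Submodule.mem_top
    simp [φ, h.symm, (hw n').ne'] at this
  have := Measure.addHaar_submodule volume _ hφ
  rw [ae_iff]
  refine measure_mono_null ?_ this
  intro r hr
  simp only [Set.mem_ofPred_eq, ne_eq, not_not] at hr
  simp only [SetLike.mem_coe, LinearMap.mem_ker, φ, LinearMap.sub_apply, LinearMap.smul_apply,
    LinearMap.proj_apply, smul_eq_mul]
  linarith

lemma ae_generic {N : ℕ} (A : Fin N → Item m u) (hA : ∀ n, 1 ≤ (A n).weight) :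
    ∀ᵐ r ∂uniformLaw N, Generic A r := by
  have hw : ∀ n, 0 < (A n).weight := fun n => by linarith [hA n]
  have h1 : ∀ᵐ r ∂uniformLaw N, ∀ n, r n ∈ Set.Ioo (0 : ℝ) 1 :=
    ae_all_iff.2 fun n => ae_eval n (ae_restrict_mem measurableSet_Ioo)
  have h2 : ∀ᵐ r ∂uniformLaw N, ∀ n j, r n ≠ (A n).weight / tau j := by
    refine ae_all_iff.2 fun n => ae_all_iff.2 fun j => ae_eval n (p := fun x => x ≠ (A n).weight / tau j) ?_
    exact ae_restrict_of_ae (Measure.ae_ne volume _)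
  have h3 : ∀ᵐ r ∂uniformLaw N, ∀ n n', n ≠ n' → 
      r n * (A n').weight - r n' * (A n).weight ≠ 0 := by
    refine ae_all_iff.2 fun n => ae_all_iff.2 fun n' => ?_
    by_cases h : n = n'
    · simp [h]
    · filter_upwards [ae_priority_ne hw h] with r hr _ using hr
  filter_upwards [h1, h2, h3] with r h1 h2 h3
  refine ⟨fun n => (h1 n).1, fun n => (h1 n).2, fun n j h => h2 n j ?_, fun n n' h => ?_⟩
  · have := (h1 n).1
    rw [← h]
    field_simp [(hw n).ne']
  · by_contra hne
    refine h3 n n' hne ?_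
    have e1 := (h1 n).1.ne'
    have e2 := (h1 n').1.ne'
    simp only at h
    rw [div_eq_div_iff e1 e2] at h
    linarith

/-- A lower bound for the probability of an event whose complement is almost surely covered by
an unlikely one. -/
lemma one_sub_le_real {N : ℕ} {S B : Set (Fin N → ℝ)} {δ : ℝ}
    (h : ∀ᵐ r ∂uniformLaw N, r ∉ B → r ∈ S) (hB : (uniformLaw N).real B ≤ δ) :
    1 - δ ≤ (uniformLaw N).real S := by
  have h1 : (uniformLaw N).real Set.univ ≤ (uniformLaw N).real (B ∪ S) := by
    rw [Measure.real, Measure.real]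
    refine ENNReal.toReal_mono (measure_ne_top _ _) (measure_mono_ae ?_)
    filter_upwards [h] with r hr _
    by_cases hb : r ∈ B
    · exact Or.inl hb
    · exact Or.inr (hr hb)
  have h2 := measureReal_union_le (μ := uniformLaw N) B S
  rw [probReal_univ] at h1
  linarith

/-! ### Chernoff bounds for the number of large priorities -/

/-- The number of indices in `F` whose priority exceeds `t`. -/
def hits {N : ℕ} (w : Fin N → ℝ) (F : Finset (Fin N)) (t : ℝ) (r : Fin N → ℝ) : ℝ :=
  ∑ n ∈ F, if t < w n / r n then 1 else 0

/-- The expected value of `hits`. -/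
def meanHits {N : ℕ} (w : Fin N → ℝ) (F : Finset (Fin N)) (t : ℝ) : ℝ :=
  ∑ n ∈ F, min 1 (w n / t)

lemma hits_nonneg {N : ℕ} (w : Fin N → ℝ) (F : Finset (Fin N)) (t : ℝ) (r : Fin N → ℝ) :
    0 ≤ hits w F t r := Finset.sum_nonneg fun n _ => by split_ifs <;> norm_num

lemma hits_univ {N : ℕ} (w : Fin N → ℝ) (t : ℝ) (r : Fin N → ℝ) :
    hits w Finset.univ t r = countAbove (fun n => w n / r n) t := by
  simp [hits, countAbove]

lemma meanHits_nonneg {N : ℕ} {w : Fin N → ℝ} (hw : ∀ n, 0 < w n) (F : Finset (Fin N)) {t : ℝ}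
    (ht : 0 < t) : 0 ≤ meanHits w F t :=
  Finset.sum_nonneg fun n _ => by have := hw n; positivity

lemma meanHits_le {N : ℕ} (w : Fin N → ℝ) (F : Finset (Fin N)) (t : ℝ) :
    meanHits w F t ≤ (∑ n ∈ F, w n) / t := by
  rw [Finset.sum_div]
  exact Finset.sum_le_sum fun n _ => min_le_right _ _

lemma measurable_hits {N : ℕ} (w : Fin N → ℝ) (F : Finset (Fin N)) (t : ℝ) :
    Measurable (hits w F t) := by
  unfold hits
  refine Finset.measurable_fun_sum _ fun n _ => ?_
  refine Measurable.ite (measurableSet_lt measurable_const ?_) measurable_const measurable_const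
  fun_prop

lemma hits_le {N : ℕ} (w : Fin N → ℝ) (F : Finset (Fin N)) (t : ℝ) (r : Fin N → ℝ) :
    hits w F t r ≤ F.card := by
  unfold hits
  refine (Finset.sum_le_card_nsmul _ _ 1 fun n _ => ?_).trans (by simp)
  split_ifs <;> norm_num

lemma integrable_exp_hits {N : ℕ} (w : Fin N → ℝ) (F : Finset (Fin N)) (t l : ℝ) :
    Integrable (fun r => Real.exp (l * hits w F t r)) (uniformLaw N) := by
  refine Integrable.of_bound (C := Real.exp (|l| * F.card))
    (((measurable_hits w F t).const_mul l).exp.aestronglyMeasurable) (ae_of_all _ fun r => ?_)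
  rw [Real.norm_eq_abs, abs_of_pos (Real.exp_pos _), Real.exp_le_exp]
  exact mul_le_mul (le_abs_self l) (hits_le w F t r) (hits_nonneg w F t r) (abs_nonneg l)

/-- Independence turns the integral into a product of factors `1 + p * (exp l - 1) ≤ exp (p * (exp l
- 1))`. The sign of `l` is free, so both tails follow. -/
lemma integral_exp_hits_le {N : ℕ} {w : Fin N → ℝ} (hw : ∀ n, 0 < w n) (F : Finset (Fin N))
    {t : ℝ} (ht : 0 < t) (l : ℝ) :
    ∫ r, Real.exp (l * hits w F t r) ∂uniformLaw N
      ≤ Real.exp (meanHits w F t * (Real.exp l - 1)) := by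
  have h1 : ∀ r : Fin N → ℝ, Real.exp (l * hits w F t r)
      = ∏ n, (fun x => if n ∈ F then 1 + (Real.exp l - 1) * {x | t < w n / x}.indicator 1 x
          else 1) (r n) := by
    intro r
    rw [hits, Finset.mul_sum, Real.exp_sum, Finset.prod_ite_mem, Finset.univ_inter]
    refine Finset.prod_congr rfl fun n _ => ?_
    by_cases h : t < w n / r n <;> simp [h, Set.indicator]
  have hm : ∀ n, MeasurableSet {x | t < w n / x} := fun n =>
    measurableSet_lt measurable_const (by fun_prop)
  rw [integral_congr_ae (ae_of_all _ h1), uniformLaw_eq,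
    integral_fintype_prod_eq_prod (fun n x =>
      if n ∈ F then 1 + (Real.exp l - 1) * {x | t < w n / x}.indicator 1 x else 1), meanHits, Finset.sum_mul, Real.exp_sum,
    ← Finset.univ_inter F, ← Finset.prod_ite_mem]
  have h2 : ∀ n, ∫ x, 1 + (Real.exp l - 1) * {x | t < w n / x}.indicator 1 x ∂unitLaw
      = 1 + (Real.exp l - 1) * min 1 (w n / t) := by
    intro n
    have hi : Integrable ({x | t < w n / x}.indicator (1 : ℝ → ℝ)) unitLaw :=
      (integrable_const (1 : ℝ)).indicator (hm n)
    rw [integral_add (integrable_const _) (hi.const_mul _), integral_const_mul,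
      integral_indicator_one (hm n), unitLaw_real_priority (hw n) ht]
    simp
  have h3 : ∀ n, 0 ≤ 1 + (Real.exp l - 1) * min 1 (w n / t) := by
    intro n
    have := hw n
    have e1 : 0 ≤ min 1 (w n / t) := by positivity
    have e2 : min 1 (w n / t) ≤ 1 := min_le_left _ _
    nlinarith [mul_nonneg (Real.exp_pos l).le e1]
  refine Finset.prod_le_prod (fun n _ => ?_) fun n _ => ?_
  · split_ifs
    · rw [h2]; exact h3 n
    · simp
  · simp only [Finset.univ_inter]
    split_ifs with hn
    · rw [h2]
      linarith [Real.add_one_le_exp (min 1 (w n / t) * (Real.exp l - 1))]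
    · simp

lemma hits_upper_tail {N : ℕ} {w : Fin N → ℝ} (hw : ∀ n, 0 < w n) (F : Finset (Fin N))
    {t : ℝ} (ht : 0 < t) {l : ℝ} (hl : 0 ≤ l) (b : ℝ) :
    (uniformLaw N).real {r | b ≤ hits w F t r}
      ≤ Real.exp (meanHits w F t * (Real.exp l - 1) - l * b) := by
  refine (ProbabilityTheory.measure_ge_le_exp_mul_mgf b hl (integrable_exp_hits w F t l)).trans ?_
  rw [sub_eq_neg_add, Real.exp_add, neg_mul]
  exact mul_le_mul_of_nonneg_left (integral_exp_hits_le hw F ht l) (Real.exp_pos _).le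

lemma hits_lower_tail {N : ℕ} {w : Fin N → ℝ} (hw : ∀ n, 0 < w n) (F : Finset (Fin N))
    {t : ℝ} (ht : 0 < t) {l : ℝ} (hl : 0 ≤ l) (b : ℝ) :
    (uniformLaw N).real {r | hits w F t r ≤ b}
      ≤ Real.exp (meanHits w F t * (Real.exp (-l) - 1) + l * b) := by
  refine (ProbabilityTheory.measure_le_le_exp_mul_mgf b (neg_nonpos.2 hl)
    (integrable_exp_hits w F t (-l))).trans ?_
  rw [add_comm, Real.exp_add, neg_neg]
  exact mul_le_mul_of_nonneg_left (integral_exp_hits_le hw F ht (-l)) (Real.exp_pos _).le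

/-- An upper tail bound that vanishes with the mean. -/
lemma hits_upper_tail_sub_one {N : ℕ} {w : Fin N → ℝ} (hw : ∀ n, 0 < w n) (F : Finset (Fin N))
    {t : ℝ} (ht : 0 < t) {l : ℝ} (hl : 0 ≤ l) (b : ℝ) :
    (Real.exp (l * b) - 1) * (uniformLaw N).real {r | b ≤ hits w F t r}
      ≤ Real.exp (meanHits w F t * (Real.exp l - 1)) - 1 := by
  -- Markov's inequality is applied to `exp (l * X) - 1` instead of `exp (l * X)`; this is what
  -- makes the bound vanish with the mean.
  have hint := (integrable_exp_hits w F t l).sub (integrable_const (1 : ℝ))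
  have h1 := mul_meas_ge_le_integral_of_nonneg (μ := uniformLaw N)
    (f := fun r => Real.exp (l * hits w F t r) - 1)
    (ae_of_all _ fun r => sub_nonneg.2 (Real.one_le_exp (mul_nonneg hl (hits_nonneg w F t r))))
    hint (Real.exp (l * b) - 1)
  rw [integral_sub (integrable_exp_hits w F t l) (integrable_const _)] at h1
  have h2 := integral_exp_hits_le hw F ht l
  have h3 : {r | b ≤ hits w F t r} ⊆
      {r | Real.exp (l * b) - 1 ≤ Real.exp (l * hits w F t r) - 1} := by
    intro r hr
    simp only [Set.mem_ofPred_eq, sub_le_sub_iff_right, Real.exp_le_exp] at hr ⊢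
    exact mul_le_mul_of_nonneg_left hr hl
  simp only [integral_const, probReal_univ, smul_eq_mul, mul_one] at h1
  rcases le_or_gt 0 (Real.exp (l * b) - 1) with h0 | h0
  · have := mul_le_mul_of_nonneg_left
      (measureReal_mono (μ := uniformLaw N) h3 (measure_ne_top _ _)) h0
    linarith
  · have e1 : 0 ≤ meanHits w F t * (Real.exp l - 1) :=
      mul_nonneg (meanHits_nonneg hw F ht) (sub_nonneg.2 (Real.one_le_exp hl))
    have e2 := Real.one_le_exp e1
    have e3 : 0 ≤ (uniformLaw N).real {r | b ≤ hits w F t r} := measureReal_nonneg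
    nlinarith

/-! ### The potential that counts messages -/

/-- The factor by which the potential changes when an item of priority `p` meets the
threshold `t`: `1` if it is not sent, `2 / 3` if it joins the upper queue, `4 / 3` otherwise. -/
def factor (t p : ℝ) : ℝ := 1 + (if t < p then 1 / 3 else 0) - (if 2 * t < p then 2 / 3 else 0)

/-- `(4 / 3) ^ a * (1 / 2) ^ b`, if `a` items are sent and `b` of them join the upper queue. -/
def potential (s : ℕ) : (N : ℕ) → (Fin N → ℝ) → (Fin N → ℝ) → ℝ
  | 0, _, _ => 1
  | N + 1, w, r => potential s N (fun n => w n.castSucc) (fun n => r n.castSucc) *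
      factor (tau (roundOf s fun n : Fin N => w n.castSucc / r n.castSucc))
        (w (Fin.last N) / r (Fin.last N))

lemma factor_nonneg {t : ℝ} (ht : 0 < t) (p : ℝ) : 0 ≤ factor t p := by
  unfold factor
  split_ifs <;> linarith

lemma potential_nonneg (s N : ℕ) (w r : Fin N → ℝ) : 0 ≤ potential s N w r := by
  induction N with
  | zero => exact zero_le_one
  | succ N ih => exact mul_nonneg (ih _ _) (factor_nonneg (tau_pos _) _)

lemma run_succ (s : ℕ) {N : ℕ} (A : Fin (N + 1) → Item m u) (r : Fin (N + 1) → ℝ) :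
    run s A r = step s (run s (fun n => A n.castSucc) fun n => r n.castSucc)
      (A (Fin.last N), r (Fin.last N)) := by
  unfold run
  rw [List.ofFn_succ', List.concat_eq_append, List.foldl_append]
  rfl

lemma Generic.castSucc {N : ℕ} {A : Fin (N + 1) → Item m u} {r : Fin (N + 1) → ℝ}
    (h : Generic A r) : Generic (fun n => A n.castSucc) fun n => r n.castSucc :=
  ⟨fun _ => h.pos _, fun _ => h.lt_one _, fun _ => h.ne_tau _,
    fun _ _ e => Fin.castSucc_injective _ (h.inj e)⟩

lemma potential_run {s : ℕ} (hs : 1 ≤ s) {N : ℕ} (A : Fin N → Item m u) (r : Fin N → ℝ)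
    (hr : Generic A r) : ∃ sent up : ℕ,
      potential s N (fun n => (A n).weight) r = (4 / 3) ^ sent * (1 / 2) ^ up ∧
      (run s A r).messages = sent + m * (run s A r).round ∧
      up ≤ s * (run s A r).round + (run s A r).upper.length := by
  induction N with
  | zero => exact ⟨0, 0, by simp [potential], by simp [run, init], by simp⟩
  | succ N ih =>
    obtain ⟨sent, up, h1, h2, h3⟩ := ih _ _ hr.castSucc
    have hv := valid_run hs _ _ hr.castSucc
    have hround := round_run hs _ _ hr.castSucc
    rw [potential, run_succ, h1, ← hround]
    set σ := run s (fun n => A n.castSucc) fun n => r n.castSucc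
    set p := (A (Fin.last N), r (Fin.last N)) with hp
    have hprio : (A (Fin.last N)).weight / r (Fin.last N) = (toTriple p).priority := rfl
    have hpos := tau_pos σ.round
    rw [hprio]
    rcases lt_or_gt_of_ne (hr.ne_tau (Fin.last N) σ.round) with hlt | hgt
    · rw [hprio] at hlt
      rw [(hv.step_of_lt p hlt).1]
      refine ⟨sent, up, ?_, h2, h3⟩
      rw [factor, if_neg (by linarith), if_neg (by linarith)]; ring
    · rw [hprio] at hgt
      obtain ⟨-, k, k1, k2, k3⟩ := hv.step_of_gt hs p hgt
      have hup := hv.upper_lt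
      rw [k1, k2, factor, if_pos hgt]
      -- The upper queue held fewer than `s` items, so after the arrival it has at most `s`; a
      -- single ended round already pays for all of them.
      have hk : σ.upper.length + (if 2 * tau σ.round < (toTriple p).priority then 1 else 0)
          ≤ s * k + (step s σ p).upper.length := by
        rcases Nat.eq_zero_or_pos k with h0 | h0
        · rw [k3 h0]; omega
        · have : s * 1 ≤ s * k := Nat.mul_le_mul_left s h0
          split_ifs <;> omega
      rw [mul_add, mul_add, h2]
      split_ifs at hk ⊢ with h
      · exact ⟨sent + 1, up + 1, by ring, by ring, by omega⟩
      · exact ⟨sent + 1, up, by ring, by ring, by omega⟩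

lemma exists_countAbove_lt {s : ℕ} (hs : 1 ≤ s) {N : ℕ} (ρ : Fin N → ℝ) :
    ∃ j, countAbove ρ (2 * tau j) < s := by
  obtain ⟨M, hM⟩ := (Set.finite_range ρ).bddAbove
  obtain ⟨j, hj⟩ := pow_unbounded_of_one_lt M (one_lt_two (α := ℝ))
  have hj' : M < tau j := hj
  refine ⟨j, ?_⟩
  rw [countAbove, Finset.filter_false_of_mem, Finset.card_empty]
  · exact hs
  · intro n _
    have := hM (Set.mem_range_self n)
    have := tau_pos j
    linarith

lemma measurable_roundOf {s : ℕ} (hs : 1 ≤ s) {N : ℕ} (w : Fin N → ℝ) :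
    Measurable fun r : Fin N → ℝ => roundOf s fun n => w n / r n := by
  classical
  have h : ∀ r : Fin N → ℝ, ∃ j, countAbove (fun n => w n / r n) (2 * tau j) < s :=
    fun r => exists_countAbove_lt hs _
  have : (fun r : Fin N → ℝ => roundOf s fun n => w n / r n) = fun r => Nat.find (h r) :=
    funext fun r =>
    le_antisymm (Nat.sInf_le (Nat.find_spec (h r))) (Nat.find_min' (h r) (Nat.sInf_mem (h r)))
  rw [this]
  refine measurable_find h fun k => ?_
  have e : {r : Fin N → ℝ | countAbove (fun n => w n / r n) (2 * tau k) < s}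
      = {r | hits w Finset.univ (2 * tau k) r < s} := by
    ext r
    simp only [Set.mem_ofPred_eq, hits_univ, Nat.cast_lt]
  rw [e]
  exact measurableSet_lt (measurable_hits _ _ _) measurable_const

lemma measurable_factor : Measurable fun q : ℝ × ℝ => factor q.1 q.2 := by
  unfold factor
  refine (measurable_const.add (Measurable.ite ?_ measurable_const measurable_const)).sub
    (Measurable.ite ?_ measurable_const measurable_const)
  · exact measurableSet_lt measurable_fst measurable_snd
  · exact measurableSet_lt (measurable_fst.const_mul 2) measurable_snd

lemma measurable_potential {s : ℕ} (hs : 1 ≤ s) {N : ℕ} (w : Fin N → ℝ) :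
    Measurable (potential s N w) := by
  induction N with
  | zero => exact measurable_const
  | succ N ih =>
    have hr : Measurable fun r : Fin (N + 1) → ℝ => fun n : Fin N => r n.castSucc := by fun_prop
    refine ((ih _).comp hr).mul (measurable_factor.comp (Measurable.prodMk ?_ (by fun_prop)))
    exact (measurable_of_countable tau).comp ((measurable_roundOf hs _).comp hr)

/-- Halving the level at most doubles the probability of exceeding it: `min 1 (w / t) ≤ 2 * min 1 (w
/ (2 * t))`. The weights `1 / 3` and `2 / 3` in `factor` are chosen to balance exactly then. -/
lemma lintegral_factor_le {w t : ℝ} (hw : 0 < w) (ht : 0 < t) :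
    ∫⁻ x, ENNReal.ofReal (factor t (w / x)) ∂unitLaw ≤ 1 := by
  have hm : ∀ t, MeasurableSet {x : ℝ | t < w / x} := fun t =>
    measurableSet_lt measurable_const (by fun_prop)
  have hi : ∀ t, Integrable ({x | t < w / x}.indicator (1 : ℝ → ℝ)) unitLaw := fun t =>
      (integrable_const (1 : ℝ)).indicator (hm t)
  have he : ∀ x, factor t (w / x) = 1 + (1 / 3) * {x | t < w / x}.indicator (1 : ℝ → ℝ) x
      - (2 / 3) * {x | 2 * t < w / x}.indicator (1 : ℝ → ℝ) x := by
    intro x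
    unfold factor
    by_cases h1 : t < w / x <;> by_cases h2 : 2 * t < w / x <;> simp [h1, h2, Set.indicator]
  have hint1 : Integrable
      (fun x => 1 + (1 / 3) * {x | t < w / x}.indicator (1 : ℝ → ℝ) x) unitLaw :=
    (integrable_const (1 : ℝ)).add ((hi t).const_mul (1 / 3))
  have hint2 := (hi (2 * t)).const_mul (2 / 3)
  rw [← ofReal_integral_eq_lintegral_ofReal _ (ae_of_all _ fun x => factor_nonneg ht _)]
  · rw [← ENNReal.ofReal_one]
    refine ENNReal.ofReal_le_ofReal ?_
    rw [integral_congr_ae (ae_of_all _ he), integral_sub hint1 hint2,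
      integral_add (integrable_const _) ((hi t).const_mul _), integral_const_mul,
      integral_const_mul, integral_indicator_one (hm t), integral_indicator_one (hm _),
      unitLaw_real_priority hw ht, unitLaw_real_priority hw (by positivity)]
    simp only [integral_const, probReal_univ, smul_eq_mul, mul_one]
    have : min 1 (w / t) ≤ 2 * min 1 (w / (2 * t)) := by
      rw [mul_min_of_nonneg _ _ (by norm_num : (0:ℝ) ≤ 2)]
      refine le_min ((min_le_left _ _).trans (by norm_num)) ((min_le_right _ _).trans_eq ?_)
      field_simp
    linarith
  · exact (hint1.sub hint2).congr (ae_of_all _ fun x => (he x).symm)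

/-- The supermartingale step: the last random number is integrated first, with the others fixed.
They determine the round, so its threshold is a constant in the inner integral. -/
lemma lintegral_potential_le {s : ℕ} (hs : 1 ≤ s) {N : ℕ} {w : Fin N → ℝ} (hw : ∀ n, 0 < w n) :
    ∫⁻ r, ENNReal.ofReal (potential s N w r) ∂uniformLaw N ≤ 1 := by
  induction N with
  | zero => simp [potential]
  | succ N ih =>
    have hmp := measurePreserving_piFinSuccAbove (fun _ : Fin (N + 1) => unitLaw) (Fin.last N)
    set G : ℝ × (Fin N → ℝ) → ENNReal := fun q =>
      ENNReal.ofReal (potential s N (fun n => w n.castSucc) q.2) *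
        ENNReal.ofReal (factor (tau (roundOf s fun n : Fin N => w n.castSucc / q.2 n))
          (w (Fin.last N) / q.1)) with hG
    have hGm : Measurable G := by
      refine Measurable.mul (Measurable.ennreal_ofReal ((measurable_potential hs _).comp measurable_snd))
        (Measurable.ennreal_ofReal (measurable_factor.comp (Measurable.prodMk ?_ (by fun_prop))))
      exact (measurable_of_countable tau).comp ((measurable_roundOf hs _).comp measurable_snd)
    have e1 : ∀ r : Fin (N + 1) → ℝ, ENNReal.ofReal (potential s (N + 1) w r)
        = G (MeasurableEquiv.piFinSuccAbove (fun _ => ℝ) (Fin.last N) r) := by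
      intro r
      rw [potential, ENNReal.ofReal_mul (potential_nonneg _ _ _ _)]
      have e2 : MeasurableEquiv.piFinSuccAbove (fun _ => ℝ) (Fin.last N) r
          = (r (Fin.last N), fun n => r n.castSucc) :=
        Prod.ext rfl (funext fun n => congrArg r (Fin.succAbove_last_apply n))
      rw [e2]
    rw [uniformLaw_eq, lintegral_congr e1, hmp.lintegral_comp hGm,
      lintegral_prod_symm _ hGm.aemeasurable]
    refine le_trans (lintegral_mono fun r => ?_) (ih fun n => hw n.castSucc)
    simp only [hG]
    rw [lintegral_const_mul]
    · exact (mul_le_mul_right (lintegral_factor_le (hw _) (tau_pos _)) _).trans_eq (mul_one _)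
    · exact Measurable.ennreal_ofReal (measurable_factor.comp (Measurable.prodMk measurable_const (by fun_prop)))

lemma potential_tail {s : ℕ} (hs : 1 ≤ s) {N : ℕ} {w : Fin N → ℝ} (hw : ∀ n, 0 < w n)
    (x : ℝ) : (uniformLaw N).real {r | Real.exp x ≤ potential s N w r} ≤ Real.exp (-x) := by
  have h1 := mul_meas_ge_le_lintegral (μ := uniformLaw N)
    (Measurable.ennreal_ofReal (measurable_potential hs w)) (ENNReal.ofReal (Real.exp x))
  have h2 := h1.trans (lintegral_potential_le hs hw)
  have h3 : {r : Fin N → ℝ | Real.exp x ≤ potential s N w r} ⊆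
      {r | ENNReal.ofReal (Real.exp x) ≤ ENNReal.ofReal (potential s N w r)} :=
    fun r hr => ENNReal.ofReal_le_ofReal hr
  have h4 := (mul_le_mul_right (measure_mono h3) _).trans h2
  have h5 := ENNReal.toReal_mono ENNReal.one_ne_top h4
  rw [ENNReal.toReal_mul, ENNReal.toReal_ofReal (Real.exp_pos _).le, ENNReal.toReal_one] at h5
  rw [Real.exp_neg, ← one_div, le_div_iff₀' (Real.exp_pos x)]
  exact h5

/-! ### Number of rounds and messages -/

lemma two_mul_exp_le {s : ℕ} (hs : 1 ≤ s) :
    Real.exp (-2 * s) + Real.exp (-2 * s) ≤ Real.exp (-1 * s) := by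
  have h1 : (1 : ℝ) ≤ s := by exact_mod_cast hs
  have h2 : Real.exp (-2 * s) = Real.exp (-1 * s) * Real.exp (-s) := by
    rw [← Real.exp_add]; ring_nf
  have h3 : Real.exp (-(s : ℝ)) ≤ 1 / 2 := by
    rw [Real.exp_neg, ← one_div]
    exact one_div_le_one_div_of_le (by norm_num) (by linarith [Real.add_one_le_exp (s : ℝ)])
  nlinarith [Real.exp_pos (-1 * (s : ℝ))]

lemma exp_two_mul_le {s : ℕ} (hs : 1 ≤ s) : Real.exp (-2 * s) ≤ Real.exp (-1 * s) :=
  Real.exp_le_exp.2 (by have : (0 : ℝ) ≤ s := by positivity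
                        linarith)

lemma exp_three_le : Real.exp 3 ≤ 33 := by
  have h : Real.exp 3 = Real.exp 1 ^ 3 := by rw [← Real.exp_nat_mul]; norm_num
  have h2 := Real.exp_one_lt_d9.le
  rw [h]
  calc Real.exp 1 ^ 3 ≤ 2.7182818286 ^ 3 := pow_le_pow_left₀ (Real.exp_pos _).le h2 3
    _ ≤ 33 := by norm_num

/-- Few priorities lie far above `W / s`. -/
lemma many_hits_tail {N : ℕ} {w : Fin N → ℝ} (hw : ∀ n, 0 < w n) {s : ℕ} {t : ℝ} (ht : 0 < t)
    (h : 32 * (∑ n, w n) ≤ s * t) :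
    (uniformLaw N).real {r | (s : ℝ) ≤ hits w Finset.univ t r} ≤ Real.exp (-2 * s) := by
  -- With mean at most `s / 32` and `exp 3 - 1 ≤ 32`, the exponent is at most `s - 3 * s`.
  refine (hits_upper_tail hw Finset.univ ht (l := 3) (by norm_num) s).trans ?_
  rw [Real.exp_le_exp]
  have h1 := meanHits_le w Finset.univ t
  have h2 : (∑ n, w n) / t ≤ s / 32 := by
    rw [div_le_div_iff₀ ht (by norm_num)]; linarith
  have h3 := meanHits_nonneg hw Finset.univ ht
  have := exp_three_le
  nlinarith

lemma exists_round_bound {N : ℕ} {w : Fin N → ℝ} {β : ℝ} (hw : ∀ n, 0 < w n ∧ w n ≤ β) {s : ℕ}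
    (hs : 1 ≤ s) (h : 2 * (s : ℝ) ≤ β * N) :
    ∃ i : ℕ, (i : ℝ) + 1 ≤ 12 * Real.log (β * N / s) ∧
      (uniformLaw N).real {r | (s : ℝ) ≤ hits w Finset.univ (2 * tau i) r}
        ≤ Real.exp (-2 * s) := by
  have hs' : (0 : ℝ) < s := by positivity
  have hx : 2 ≤ β * N / s := (le_div_iff₀ hs').2 h
  set x := β * N / s with hxdef
  -- `i` satisfies `2 ^ i ≤ 32 * x < 2 ^ (i + 1)`: the upper bound makes `2 * tau i` large enough
  -- for `many_hits_tail`, the lower one bounds `i` by a logarithm. The additive constant from `32`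
  -- is absorbed using `log x ≥ log 2`.
  obtain ⟨i, h1, h2⟩ := exists_nat_pow_near (x := 32 * x) (by linarith) (one_lt_two (α := ℝ))
  have hlx : Real.log 2 ≤ Real.log x := Real.log_le_log (by norm_num) hx
  have hl2 := Real.log_two_gt_d9
  refine ⟨i, ?_, many_hits_tail (fun n => (hw n).1) (mul_pos two_pos (tau_pos i)) ?_⟩
  · have h3 := Real.log_le_log (by positivity) h1
    rw [Real.log_pow, Real.log_mul (by norm_num) (by positivity),
      show (32 : ℝ) = 2 ^ 5 by norm_num, Real.log_pow] at h3
    push_cast at h3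
    nlinarith
  · have h3 : ∑ n, w n ≤ β * N := by
      refine (Finset.sum_le_sum fun n _ => (hw n).2).trans_eq ?_
      simp [mul_comm]
    have h4 : β * N = x * s := by rw [hxdef]; field_simp
    have h5 : 32 * x ≤ 2 * tau i := by rw [← tau_succ]; exact h2.le
    nlinarith

lemma rounds_tail {N : ℕ} (A : Fin N → Item m u) {β : ℝ}
    (hA : ∀ n, 1 ≤ (A n).weight ∧ (A n).weight ≤ β) {s : ℕ} (hs : 1 ≤ s)
    (h : 2 * (s : ℝ) ≤ β * N) :
    1 - Real.exp (-1 * s) ≤ (uniformLaw N).real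
      {r | ((run s A r).round : ℝ) + 1 ≤ 12 * Real.log (β * N / s)} := by
  obtain ⟨i, hi, hp⟩ := exists_round_bound (w := fun n => (A n).weight)
    (fun n => ⟨by linarith [(hA n).1], (hA n).2⟩) hs h
  refine one_sub_le_real ?_ (hp.trans (exp_two_mul_le hs))
  filter_upwards [ae_generic A fun n => (hA n).1] with r hr hB
  simp only [hits_univ, Nat.cast_le, not_le] at hB ⊢
  have h1 : (run s A r).round ≤ i := round_le_of_countAbove_lt hs A r hr hB
  have h2 : ((run s A r).round : ℝ) ≤ i := by exact_mod_cast h1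
  linarith

lemma messages_tail {N : ℕ} (A : Fin N → Item m u) {β : ℝ}
    (hA : ∀ n, 1 ≤ (A n).weight ∧ (A n).weight ≤ β) {s : ℕ} (hs : 1 ≤ s)
    (h : 2 * (s : ℝ) ≤ β * N) :
    1 - Real.exp (-1 * s) ≤ (uniformLaw N).real
      {r | ((run s A r).messages : ℝ) ≤ 100 * (((m : ℝ) + s) * Real.log (β * N / s))} := by
  have hw : ∀ n, 0 < (A n).weight := fun n => by linarith [(hA n).1]
  obtain ⟨i, hi, hp⟩ := exists_round_bound (w := fun n => (A n).weight)
    (fun n => ⟨hw n, (hA n).2⟩) hs h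
  have hpot := potential_tail hs hw (2 * s : ℝ)
  rw [← neg_mul] at hpot
  refine one_sub_le_real ?_ (((measureReal_union_le _ _).trans (add_le_add hp hpot)).trans
    (two_mul_exp_le hs))
  filter_upwards [ae_generic A fun n => (hA n).1] with r hr hB
  simp only [Set.mem_union, Set.mem_ofPred_eq, hits_univ, Nat.cast_le, not_or, not_le] at hB ⊢
  have h1 : (run s A r).round ≤ i := round_le_of_countAbove_lt hs A r hr hB.1
  obtain ⟨sent, up, e1, e2, e3⟩ := potential_run hs A r hr
  have hu := (valid_run hs A r hr).upper_lt
  have hs' : (1 : ℝ) ≤ s := by exact_mod_cast hs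
  set y := Real.log (β * N / s) with hy
  have hy2 : 0.69 ≤ y := by
    have hx : 2 ≤ β * N / s := (le_div_iff₀ (by positivity)).2 h
    have hlx : Real.log 2 ≤ y := Real.log_le_log (by norm_num) hx
    linarith [Real.log_two_gt_d9]
  have hround : ((run s A r).round : ℝ) + 1 ≤ 12 * y := by
    have h2 : ((run s A r).round : ℝ) ≤ i := by exact_mod_cast h1
    linarith
  have hup : (up : ℝ) ≤ s * (12 * y) := by
    have h3 : (up : ℝ) ≤ s * ((run s A r).round + 1) := by
      have : up ≤ s * ((run s A r).round + 1) := by rw [mul_add]; omega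
      exact_mod_cast this
    exact h3.trans (by gcongr)
  -- From `exp (1 / 4) ≤ 4 / 3` and `exp (-1) ≤ 1 / 2`. A potential below `exp (2 * s)` then forces
  -- `sent < 4 * up + 8 * s`.
  have hpot2 : Real.exp ((sent : ℝ) / 4 - up) ≤ (4 / 3) ^ sent * (1 / 2) ^ up := by
    have f1 : Real.exp (1 / 4) ≤ 4 / 3 := by
      have : Real.exp (1 / 4) ^ 4 ≤ (4 / 3) ^ 4 := by
        rw [← Real.exp_nat_mul]
        norm_num
        linarith [Real.exp_one_lt_d9]
      exact le_of_pow_le_pow_left₀ (by norm_num) (by norm_num) this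
    have f2 : Real.exp (-1) ≤ 1 / 2 := by
      rw [Real.exp_neg, ← one_div]
      exact one_div_le_one_div_of_le (by norm_num) (by linarith [Real.add_one_le_exp (1 : ℝ)])
    rw [sub_eq_add_neg, Real.exp_add]
    refine mul_le_mul ?_ ?_ (Real.exp_pos _).le (by positivity)
    · rw [show (sent : ℝ) / 4 = sent * (1 / 4) by ring, Real.exp_nat_mul]
      exact pow_le_pow_left₀ (Real.exp_pos _).le f1 _
    · rw [show -(up : ℝ) = up * (-1) by ring, Real.exp_nat_mul]
      exact pow_le_pow_left₀ (Real.exp_pos _).le f2 _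
  have hlt : (sent : ℝ) / 4 - up < 2 * s := by
    rw [← Real.exp_lt_exp]
    exact hpot2.trans_lt (e1 ▸ hB.2)
  have hmess : ((run s A r).messages : ℝ) = sent + m * (run s A r).round := by exact_mod_cast e2
  rw [hmess]
  have hm : (m : ℝ) * (run s A r).round ≤ m * (12 * y) := by gcongr; linarith
  have hm0 : (0 : ℝ) ≤ m * y := by positivity
  have hsy : 0.69 * (s : ℝ) ≤ s * y := by nlinarith
  nlinarith

/-! ### Size of the sample -/

lemma meanHits_le_two_mul {N : ℕ} {w : Fin N → ℝ} (F : Finset (Fin N)) (t : ℝ) :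
    meanHits w F t ≤ 2 * meanHits w F (2 * t) := by
  unfold meanHits
  rw [Finset.mul_sum]
  refine Finset.sum_le_sum fun n _ => ?_
  rw [mul_min_of_nonneg _ _ (by norm_num : (0:ℝ) ≤ 2)]
  refine le_min ((min_le_left _ _).trans (by norm_num)) ((min_le_right _ _).trans_eq ?_)
  field_simp

lemma held_tail {N : ℕ} (A : Fin N → Item m u) (hA : ∀ n, 1 ≤ (A n).weight) {s : ℕ}
    (hs : 1 ≤ s) :
    1 - Real.exp (-1 * s) ≤ (uniformLaw N).real
      {r | ((run s A r).held.length : ℝ) ≤ 32 * s} := by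
  have hw : ∀ n, 0 < (A n).weight := fun n => by linarith [hA n]
  have hs' : (1 : ℝ) ≤ s := by exact_mod_cast hs
  have hex : ∃ k, meanHits (fun n => (A n).weight) Finset.univ (tau k) < 8 * s := by
    obtain ⟨k, hk⟩ := pow_unbounded_of_one_lt (∑ n, (A n).weight) (one_lt_two (α := ℝ))
    refine ⟨k, (meanHits_le _ _ _).trans_lt ?_⟩
    have : (∑ n, (A n).weight) / tau k < 1 := (div_lt_one (tau_pos k)).2 hk
    linarith
  classical
  have hfind := Nat.find_spec hex
  rcases Nat.eq_zero_or_eq_succ_pred (Nat.find hex) with h0 | h0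
  -- At `tau 0 = 1` every success probability is `1`, so the mean is `N` and the whole stream is
  -- short.
  · rw [h0] at hfind
    have hN : (N : ℝ) < 8 * s := by
      refine lt_of_eq_of_lt ?_ hfind
      rw [meanHits, Finset.sum_congr rfl (g := fun _ => 1)]
      · simp
      · intro n _
        simp [tau, hA n]
    refine one_sub_le_real (B := ∅) ?_ (by simp [Real.exp_nonneg])
    filter_upwards [ae_generic A hA] with r hr _
    rw [length_held hs A r hr]
    have : (countAbove (fun n => (A n).weight / r n) (tau (run s A r).round) : ℝ) ≤ N := by
      exact_mod_cast countAbove_le _ _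
    linarith
  · set k := (Nat.find hex).pred
    have hk1 : 8 * (s : ℝ) ≤ meanHits (fun n => (A n).weight) Finset.univ (tau k) :=
      not_lt.1 (Nat.find_min hex (by omega))
    have hk2 : meanHits (fun n => (A n).weight) Finset.univ (tau k) ≤ 16 * s := by
      rw [h0, tau_succ] at hfind
      -- One level higher the mean is below `8 * s`, and doubling the level at most halves it.
      linarith [meanHits_le_two_mul (w := fun n => (A n).weight) Finset.univ (tau k)]
    have t1 := hits_lower_tail hw Finset.univ (tau_pos k) (l := 1) zero_le_one s
    have t2 := hits_upper_tail hw Finset.univ (tau_pos k) (l := 1) zero_le_one (32 * s)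
    have f1 : Real.exp (-1) ≤ 1 / 2 := by
      rw [Real.exp_neg, ← one_div]
      exact one_div_le_one_div_of_le (by norm_num) (by linarith [Real.add_one_le_exp (1 : ℝ)])
    have f2 := Real.exp_one_lt_d9
    have g1 : (uniformLaw N).real {r | hits (fun n => (A n).weight) Finset.univ (tau k) r ≤ s}
        ≤ Real.exp (-2 * s) := t1.trans (Real.exp_le_exp.2 (by nlinarith))
    have g2 : (uniformLaw N).real
        {r | 32 * (s : ℝ) ≤ hits (fun n => (A n).weight) Finset.univ (tau k) r}
        ≤ Real.exp (-2 * s) := t2.trans (Real.exp_le_exp.2 (by nlinarith))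
    refine one_sub_le_real ?_ (((measureReal_union_le _ _).trans (add_le_add g1 g2)).trans
      (two_mul_exp_le hs))
    filter_upwards [ae_generic A hA] with r hr hB
    simp only [Set.mem_union, Set.mem_ofPred_eq, hits_univ, Nat.cast_le, not_or, not_le] at hB ⊢
    rw [length_held hs A r hr]
    have hkj : k ≤ (run s A r).round := by
      by_contra! hlt
      have h1 := countAbove_run_lt hs A r hr
      rw [← tau_succ] at h1
      have h2 := countAbove_anti (fun n => (A n).weight / r n) (tau_mono hlt)
      have := hB.1
      have h3 : (s : ℕ) < countAbove (fun n => (A n).weight / r n) (tau k) := by exact_mod_cast this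
      exact absurd (h3.trans_le h2) (by simpa using h1.le)
    have h1 := countAbove_anti (fun n => (A n).weight / r n) (tau_mono hkj)
    have h2 : (countAbove (fun n => (A n).weight / r n) (tau (run s A r).round) : ℝ)
      ≤ countAbove (fun n => (A n).weight / r n) (tau k) := by exact_mod_cast h1
    linarith [hB.2]

/-! ### The estimate at a given threshold -/

lemma mem_triples {N : ℕ} {A : Fin N → Item m u} {r : Fin N → ℝ} {x : Triple u} :
    x ∈ triples A r ↔ ∃ n, toTriple (A n, r n) = x := by
  simp [triples_eq]

lemma Generic.eq_of_priority_eq {N : ℕ} {A : Fin N → Item m u} {r : Fin N → ℝ}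
    (hr : Generic A r) {x y : Triple u} (hx : x ∈ triples A r) (hy : y ∈ triples A r)
    (h : x.priority = y.priority) : x = y := by
  obtain ⟨n, rfl⟩ := mem_triples.1 hx
  obtain ⟨n', rfl⟩ := mem_triples.1 hy
  rw [hr.inj h]

lemma Generic.nodup_triples {N : ℕ} {A : Fin N → Item m u} {r : Fin N → ℝ}
    (hr : Generic A r) : (triples A r).Nodup := by
  rw [triples_eq, List.nodup_reverse]
  exact (List.nodup_finRange N).map fun n n' h => hr.inj (congrArg Triple.priority h)

lemma sum_map_filter {α : Type*} (l : List α) (P : α → Prop) [DecidablePred P] (g : α → ℝ) :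
    ((l.filter fun x => P x).map g).sum = (l.map fun x => if P x then g x else 0).sum := by
  induction l with
  | nil => rfl
  | cons x l ih => by_cases h : P x <;> simp [h, ih]

/-- The estimate from all items whose priority exceeds a threshold `t`. -/
def estimateAt {N : ℕ} (A : Fin N → Item m u) (r : Fin N → ℝ) (t : ℝ) (e : Fin u) : ℝ :=
  ∑ n with (A n).label = e, if t < (A n).weight / r n then max (A n).weight t else 0

lemma estimate_run {s : ℕ} (hs : 1 ≤ s) {N : ℕ} (A : Fin N → Item m u) (r : Fin N → ℝ)
    (hr : Generic A r) (hne : (run s A r).held ≠ []) :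
    0 < (run s A r).minPriority ∧
    (∀ t < (run s A r).minPriority,
      (run s A r).held.length ≤ countAbove (fun n => (A n).weight / r n) t) ∧
    ∀ e, (run s A r).estimate e = estimateAt A r (run s A r).minPriority e := by
  classical
  have hperm := held_perm hs A r hr
  set σ := run s A r
  obtain ⟨x, hx⟩ : ∃ x, σ.held.argmin Triple.priority = some x :=
    Option.ne_none_iff_exists'.1 fun h => hne (List.argmin_eq_none.1 h)
  have hmin : σ.minPriority = x.priority := by simp [State.minPriority, hx]
  have hsample : σ.sample = σ.held.erase x := by
    simp only [State.sample, hx]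
  have hxm : x ∈ σ.held := List.argmin_mem hx
  have hsub : ∀ y ∈ σ.held, y ∈ triples A r ∧ tau σ.round < y.priority := by
    intro y hy
    simpa using hperm.mem_iff.1 hy
  have hle : ∀ y ∈ σ.held, x.priority ≤ y.priority := fun y hy => List.le_of_mem_argmin hy hx
  rw [hmin]
  refine ⟨(tau_pos _).trans (hsub x hxm).2, fun t ht => ?_, fun e => ?_⟩
  · rw [← length_filter_triples, hperm.length_eq]
    have h1 : ((triples A r).filter fun y => tau σ.round < y.priority).filter
        (fun y => t < y.priority) = (triples A r).filter fun y => tau σ.round < y.priority :=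
      List.filter_eq_self.2 fun y hy =>
        decide_eq_true (ht.trans_le (hle y (hperm.mem_iff.2 hy)))
    refine (congrArg List.length h1).symm.le.trans ?_
    rw [List.filter_filter]
    refine (List.monotone_filter_right _ fun y hy => ?_).length_le
    rw [Bool.and_eq_true] at hy
    exact hy.1
  · have hnodup : σ.held.Nodup := hperm.nodup_iff.2 (hr.nodup_triples.filter _)
    -- Since priorities are distinct, erasing the one minimal item is the same as keeping everything
    -- strictly above `ρ̂`.
    have h1 : σ.held.erase x = σ.held.filter fun y => x.priority < y.priority := by
      rw [hnodup.erase_eq_filter]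
      refine List.filter_congr fun y hy => ?_
      rw [Bool.eq_iff_iff]
      simp only [bne_iff_ne, ne_eq, decide_eq_true_eq]
      constructor
      · intro h
        refine lt_of_le_of_ne (hle y hy) fun h' => h ?_
        exact hr.eq_of_priority_eq (hsub y hy).1 (hsub x hxm).1 h'.symm
      · rintro h rfl
        exact lt_irrefl _ h
    have h2 : σ.sample.Perm ((triples A r).filter fun y => x.priority < y.priority) := by
      rw [hsample, h1]
      refine (hperm.filter _).trans (List.Perm.of_eq ?_)
      rw [List.filter_filter]
      refine List.filter_congr fun y _ => ?_
      rw [Bool.eq_iff_iff]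
      simp only [Bool.and_eq_true, decide_eq_true_eq, and_iff_left_iff_imp]
      exact fun h => (hsub x hxm).2.trans h
    rw [State.estimate, hmin, ((h2.filter _).map _).sum_eq, sum_map_filter, sum_map_filter,
      triples_eq, List.map_reverse, List.sum_reverse, List.map_map, ← Fin.sum_univ_def, estimateAt,
      Finset.sum_filter]
    refine Finset.sum_congr rfl fun n _ => ?_
    simp only [Function.comp_apply, toTriple]
    split_ifs <;> rfl

/-! ### Deviation bounds proportional to the mean -/

lemma hits_upper_deviation {N : ℕ} {w : Fin N → ℝ} (hw : ∀ n, 0 < w n) (F : Finset (Fin N))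
    {t a δ : ℝ} (ht : 0 < t) (hδ : 0 < δ) (hδ1 : δ ≤ 1) (ha : meanHits w F t ≤ a)
    (hy : 2 ≤ δ ^ 2 * a) :
    (uniformLaw N).real {r | meanHits w F t + δ * a ≤ hits w F t r}
      ≤ 2 * δ * meanHits w F t * Real.exp (-(δ ^ 2 * a / 4)) := by
  have hμ := meanHits_nonneg hw F ht
  have h1 := hits_upper_tail_sub_one hw F ht (l := δ / 2) (by positivity) (meanHits w F t + δ * a)
  set μ := meanHits w F t
  set P := (uniformLaw N).real {r | μ + δ * a ≤ hits w F t r}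
  have hP : 0 ≤ P := measureReal_nonneg
  set g := μ * (Real.exp (δ / 2) - 1) with hg
  set h := δ / 2 * (μ + δ * a) with hh
  have he : Real.exp (δ / 2) - 1 ≤ δ / 2 + (δ / 2) ^ 2 := by
    have := (abs_le.1 (Real.abs_exp_sub_one_sub_id_le (x := δ / 2)
      (by rw [abs_of_pos (by positivity)]; linarith))).2
    linarith
  have hg1 : g ≤ μ * (δ / 2 + (δ / 2) ^ 2) := mul_le_mul_of_nonneg_left he hμ
  have hg2 : g ≤ δ * μ := by
    nlinarith [mul_nonneg hμ (mul_nonneg hδ.le (sub_nonneg.2 hδ1)), mul_nonneg hμ hδ.le]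
  have hg0 : 0 ≤ g := mul_nonneg hμ (sub_nonneg.2 (Real.one_le_exp (by positivity)))
  -- Up to `μ * (δ / 2) ^ 2` the term `g` cancels against `δ / 2 * μ`; what is left is at most `δ ^
  -- 2 * μ / 4 - δ ^ 2 * a / 2`, and `μ ≤ a`.
  have hgh : g - h ≤ -(δ ^ 2 * a / 4) := by nlinarith
  have hh1 : 1 ≤ h := by nlinarith
  have hexp : 2 ≤ Real.exp h := by linarith [Real.add_one_le_exp h]
  have hgexp : Real.exp g - 1 ≤ g * Real.exp g := by
    have e1 := Real.add_one_le_exp (-g)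
    have e2 : Real.exp (-g) * Real.exp g = 1 := by rw [← Real.exp_add]; simp
    nlinarith [Real.exp_pos g]
  have h2 : P * Real.exp h ≤ 2 * g * Real.exp g := by nlinarith
  have h3 : P ≤ 2 * g * Real.exp (g - h) := by
    rw [Real.exp_sub, ← mul_div_assoc, le_div_iff₀ (Real.exp_pos h)]
    exact h2
  refine h3.trans (mul_le_mul (by linarith) (Real.exp_le_exp.2 hgh) (Real.exp_pos _).le
    (by positivity))

/-- Below `δ * a` the mean is too small for the event to occur at all, as counts are nonnegative;
otherwise the prefactor is at least `1` and comes for free. -/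
lemma hits_lower_deviation {N : ℕ} {w : Fin N → ℝ} (hw : ∀ n, 0 < w n) (F : Finset (Fin N))
    {t a δ : ℝ} (ht : 0 < t) (hδ : 0 < δ) (hδ1 : δ ≤ 1) (ha : meanHits w F t ≤ a)
    (ha0 : 0 < a) :
    (uniformLaw N).real {r | hits w F t r ≤ meanHits w F t - δ * a}
      ≤ meanHits w F t / (δ * a) * Real.exp (-(δ ^ 2 * a / 4)) := by
  have hμ := meanHits_nonneg hw F ht
  rcases lt_or_ge (meanHits w F t) (δ * a) with hlt | hge
  · have : {r | hits w F t r ≤ meanHits w F t - δ * a} = ∅ := by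
      ext r
      simp only [Set.mem_ofPred_eq, Set.mem_empty_iff_false, iff_false, not_le]
      linarith [hits_nonneg w F t r]
    rw [this, measureReal_empty]
    positivity
  · have h1 := hits_lower_tail hw F ht (l := δ / 2) (by positivity) (meanHits w F t - δ * a)
    have he : Real.exp (-(δ / 2)) - 1 ≤ -(δ / 2) + (δ / 2) ^ 2 := by
      have := (abs_le.1 (Real.abs_exp_sub_one_sub_id_le (x := -(δ / 2))
        (by rw [abs_neg, abs_of_pos (by positivity)]; linarith))).2
      linarith
    have h2 := mul_le_mul_of_nonneg_left he hμ
    have h3 : 1 ≤ meanHits w F t / (δ * a) := (one_le_div (by positivity)).2 hge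
    refine (h1.trans (Real.exp_le_exp.2 (?_ : _ ≤ -(δ ^ 2 * a / 4)))).trans
      (le_mul_of_one_le_left (Real.exp_pos _).le h3)
    nlinarith

/-- An item with `t ≤ w` always has priority above `t`, because `r < 1`, and counts with its exact
weight; a lighter one counts `t` if it is hit and has mean `t * (w / t)`. -/
lemma sum_estimate_sub {N : ℕ} {w r : Fin N → ℝ} (F : Finset (Fin N))
    {t : ℝ} (ht : 0 < t) (h0 : ∀ n, 0 < r n) (h1 : ∀ n, r n < 1) :
    (∑ n ∈ F, if t < w n / r n then max (w n) t else 0) - ∑ n ∈ F, w n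
      = t * (hits w (F.filter fun n => w n < t) t r
        - meanHits w (F.filter fun n => w n < t) t) := by
  rw [hits, meanHits, Finset.sum_filter, Finset.sum_filter, ← Finset.sum_sub_distrib,
    ← Finset.sum_sub_distrib, Finset.mul_sum]
  refine Finset.sum_congr rfl fun n _ => ?_
  by_cases h : w n < t
  · have h2 : w n / t ≤ 1 := (div_le_one ht).2 h.le
    rw [if_pos h, if_pos h, min_eq_right h2, max_eq_right h.le]
    split_ifs
    · field_simp
    · field_simp
      ring
  · have h2 : t < w n / r n := by
      rw [lt_div_iff₀ (h0 n)]
      nlinarith [h0 n, h1 n]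
    rw [if_neg h, if_neg h, if_pos h2, max_eq_left (not_lt.1 h)]
    ring

lemma two_mul_add_one_mul_exp_le (y : ℝ) :
    (2 * y + 1) * Real.exp (-(y / 4)) ≤ 16 * Real.exp (-(y / 8)) := by
  have h1 : Real.exp (-(y / 4)) = Real.exp (-(y / 8)) * Real.exp (-(y / 8)) := by
    rw [← Real.exp_add]; ring_nf
  have h2 : Real.exp (-(y / 8)) * Real.exp (y / 8) = 1 := by rw [← Real.exp_add]; simp
  have h3 := Real.add_one_le_exp (y / 8)
  have h4 := Real.exp_pos (-(y / 8))
  have h5 : (2 * y + 1) * Real.exp (-(y / 8)) ≤ 16 := by nlinarith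
  rw [h1]
  nlinarith

/-- The tail of the error for one set `F` of items, proportional to the weight of `F`. -/
lemma sum_estimate_tail {N : ℕ} {w : Fin N → ℝ} (hw : ∀ n, 0 < w n) (F : Finset (Fin N))
    {t W δ : ℝ} (ht : 0 < t) (hδ : 0 < δ) (hδ1 : δ ≤ 1) (hF : ∑ n ∈ F, w n ≤ W)
    (hy : 2 ≤ δ ^ 2 * (W / t)) :
    (uniformLaw N).real {r | (∀ n, 0 < r n ∧ r n < 1) ∧
        δ * W ≤ |(∑ n ∈ F, if t < w n / r n then max (w n) t else 0) - ∑ n ∈ F, w n|}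
      ≤ (∑ n ∈ F, w n) * (16 / (W * δ) * Real.exp (-(δ ^ 2 * (W / t) / 8))) := by
  set G := F.filter fun n => w n < t with hG
  have ha0 : 0 < W / t := by
    by_contra! h
    nlinarith [sq_nonneg δ]
  have hW : 0 < W := by
    have := mul_pos ha0 ht
    rwa [div_mul_cancel₀ _ ht.ne'] at this
  have hGF : ∑ n ∈ G, w n ≤ ∑ n ∈ F, w n :=
    Finset.sum_le_sum_of_subset_of_nonneg (Finset.filter_subset _ _) fun n _ _ => (hw n).le
  have hμF : meanHits w G t ≤ (∑ n ∈ F, w n) / t :=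
    (meanHits_le w G t).trans (by gcongr)
  have ha : meanHits w G t ≤ W / t := hμF.trans (by gcongr)
  have hsub : {r : Fin N → ℝ | (∀ n, 0 < r n ∧ r n < 1) ∧
        δ * W ≤ |(∑ n ∈ F, if t < w n / r n then max (w n) t else 0) - ∑ n ∈ F, w n|} ⊆
      {r | meanHits w G t + δ * (W / t) ≤ hits w G t r} ∪
      {r | hits w G t r ≤ meanHits w G t - δ * (W / t)} := by
    rintro r ⟨h1, h2⟩
    rw [sum_estimate_sub F ht (fun n => (h1 n).1) (fun n => (h1 n).2), ← hG, abs_mul,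
      abs_of_pos ht, mul_comm t] at h2
    have h3 : δ * (W / t) ≤ |hits w G t r - meanHits w G t| := by
      rw [← mul_div_assoc, div_le_iff₀ ht]; exact h2
    rcases le_abs.1 h3 with h | h
    · left; simp only [Set.mem_ofPred_eq]; linarith
    · right; simp only [Set.mem_ofPred_eq]; linarith
  have hup := hits_upper_deviation hw G ht hδ hδ1 ha hy
  have hlo := hits_lower_deviation hw G ht hδ hδ1 ha ha0
  refine ((measureReal_mono hsub (measure_ne_top _ _)).trans
    ((measureReal_union_le _ _).trans (add_le_add hup hlo))).trans ?_
  have hexp := two_mul_add_one_mul_exp_le (δ ^ 2 * (W / t))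
  set E := Real.exp (-(δ ^ 2 * (W / t) / 4))
  set E' := Real.exp (-(δ ^ 2 * (W / t) / 8))
  have hE : 0 < E := Real.exp_pos _
  calc 2 * δ * meanHits w G t * E + meanHits w G t / (δ * (W / t)) * E
      = meanHits w G t * ((2 * δ + 1 / (δ * (W / t))) * E) := by ring
    _ ≤ (∑ n ∈ F, w n) / t * ((2 * δ + 1 / (δ * (W / t))) * E) := by gcongr
    _ = (∑ n ∈ F, w n) / (W * δ) * ((2 * (δ ^ 2 * (W / t)) + 1) * E) := by field_simp
    _ ≤ (∑ n ∈ F, w n) / (W * δ) * (16 * E') := by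
        have : 0 ≤ ∑ n ∈ F, w n := Finset.sum_nonneg fun n _ => (hw n).le
        gcongr
    _ = (∑ n ∈ F, w n) * (16 / (W * δ) * E') := by ring

/-! ### Union over labels and over a grid of thresholds -/

lemma sum_freq {N : ℕ} (A : Fin N → Item m u) : ∑ e, freq A e = totalWeight A :=
  Finset.sum_fiberwise _ _ _

lemma freq_nonneg {N : ℕ} {A : Fin N → Item m u} (hw : ∀ n, 0 < (A n).weight) (e : Fin u) :
    0 ≤ freq A e := Finset.sum_nonneg fun n _ => (hw n).le

lemma freq_le {N : ℕ} {A : Fin N → Item m u} (hw : ∀ n, 0 < (A n).weight) (e : Fin u) :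
    freq A e ≤ totalWeight A :=
  Finset.sum_le_sum_of_subset_of_nonneg (Finset.filter_subset _ _) fun n _ _ => (hw n).le

/-- At the threshold `t` the estimate of some label is off by at least `δ W`. -/
def badAt {N : ℕ} (A : Fin N → Item m u) (δ t : ℝ) : Set (Fin N → ℝ) :=
  {r | (∀ n, 0 < r n ∧ r n < 1) ∧
    ∃ e, δ * totalWeight A ≤ |estimateAt A r t e - freq A e|}

/-- Each label's bound carries the factor `freq A e`, and these add up to `totalWeight A`. Hence no
dependence on the number `u` of labels. -/
lemma badAt_tail {N : ℕ} {A : Fin N → Item m u} (hw : ∀ n, 0 < (A n).weight) {t δ : ℝ}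
    (ht : 0 < t) (hδ : 0 < δ) (hδ1 : δ ≤ 1) (hy : 2 ≤ δ ^ 2 * (totalWeight A / t)) :
    (uniformLaw N).real (badAt A δ t)
      ≤ 16 / δ * Real.exp (-(δ ^ 2 * (totalWeight A / t) / 8)) := by
  have hW : 0 < totalWeight A := by
    by_contra! h
    have := div_nonpos_of_nonpos_of_nonneg h ht.le
    nlinarith [sq_nonneg δ]
  have h1 : badAt A δ t ⊆ ⋃ e, {r | (∀ n, 0 < r n ∧ r n < 1) ∧
      δ * totalWeight A ≤ |estimateAt A r t e - freq A e|} := by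
    rintro r ⟨h, e, he⟩
    exact Set.mem_iUnion.2 ⟨e, h, he⟩
  refine ((measureReal_mono h1 (measure_ne_top _ _)).trans
    (measureReal_iUnion_fintype_le _)).trans ?_
  refine (Finset.sum_le_sum fun e _ => sum_estimate_tail hw _ ht hδ hδ1 (freq_le hw e) hy).trans ?_
  rw [← Finset.sum_mul]
  refine (mul_le_mul_of_nonneg_right (sum_freq A).le (by positivity)).trans_eq ?_
  field_simp

/-- Raising the threshold keeps fewer items and raises each `max w t` by a factor of at most `1 +
δ`. -/
lemma estimateAt_le {N : ℕ} {A : Fin N → Item m u} (hw : ∀ n, 0 < (A n).weight)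
    (r : Fin N → ℝ) {t t' δ : ℝ} (hδ : 0 < δ) (h1 : t' ≤ t)
    (h2 : t ≤ (1 + δ) * t') (e : Fin u) :
    estimateAt A r t e ≤ (1 + δ) * estimateAt A r t' e := by
  unfold estimateAt
  rw [Finset.mul_sum]
  refine Finset.sum_le_sum fun n _ => ?_
  have hwn := hw n
  by_cases h : t < (A n).weight / r n
  · rw [if_pos h, if_pos (h1.trans_lt h)]
    refine max_le ?_ (h2.trans ?_)
    · nlinarith [le_max_left (A n).weight t']
    · exact mul_le_mul_of_nonneg_left (le_max_right _ _) (by linarith)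
  · rw [if_neg h]
    split_ifs
    · have := le_max_left (A n).weight t'
      positivity
    · simp

/-- The level `t` lies between two consecutive grid points. One error `δ * W` comes from the grid,
the rest from the factor `1 + δ` and `freq A e ≤ W`. -/
lemma abs_estimateAt_sub_le {N : ℕ} {A : Fin N → Item m u} (hw : ∀ n, 0 < (A n).weight)
    {r : Fin N → ℝ} (hr : ∀ n, 0 < r n ∧ r n < 1) {t₀ δ : ℝ} (hδ : 0 < δ) (hδ1 : δ ≤ 1)
    (hgrid : ∀ i : ℕ, r ∉ badAt A δ (t₀ / (1 + δ) ^ i)) {t : ℝ} (ht : 0 < t) (htt : t ≤ t₀)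
    (e : Fin u) : |estimateAt A r t e - freq A e| ≤ 3 * δ * totalWeight A := by
  obtain ⟨i, h1, h2⟩ := exists_nat_pow_near (x := t₀ / t) ((one_le_div ht).2 htt)
    (y := 1 + δ) (by linarith)
  have hgood : ∀ i : ℕ, |estimateAt A r (t₀ / (1 + δ) ^ i) e - freq A e|
      < δ * totalWeight A := by
    intro i
    by_contra! h
    exact hgrid i ⟨hr, e, h⟩
  have hp : ∀ i : ℕ, 0 < (1 + δ) ^ i := fun i => by positivity
  have g1 : t ≤ t₀ / (1 + δ) ^ i := by
    rw [le_div_iff₀ (hp i)]; rw [le_div_iff₀ ht] at h1; linarith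
  have g2 : t₀ / (1 + δ) ^ (i + 1) ≤ t := by
    rw [div_le_iff₀ (hp _)]; rw [div_lt_iff₀ ht] at h2; linarith
  have g3 : (1 + δ) * (t₀ / (1 + δ) ^ (i + 1)) = t₀ / (1 + δ) ^ i := by
    rw [pow_succ]; field_simp
  have k1 := estimateAt_le hw r hδ g1 (by rw [← g3]; gcongr) e
  have k2 := estimateAt_le hw r hδ g2 (by rw [g3]; exact g1) e
  have b1 := abs_lt.1 (hgood i)
  have b2 := abs_lt.1 (hgood (i + 1))
  have hf := freq_le hw e
  have hf0 := freq_nonneg hw e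
  rw [abs_le]
  constructor
  · have : (1 + δ) * (freq A e - 3 * δ * totalWeight A) ≤ (1 + δ) * estimateAt A r t e := by
      nlinarith [mul_nonneg hδ.le (sub_nonneg.2 hf), mul_nonneg (sq_nonneg δ) (hf0.trans hf)]
    have := le_of_mul_le_mul_left this (by linarith)
    linarith
  · nlinarith [mul_nonneg hδ.le (sub_nonneg.2 hf), mul_nonneg hδ.le (hf0.trans hf),
      mul_nonneg (mul_nonneg hδ.le (sub_nonneg.2 hδ1)) (hf0.trans hf)]

lemma grid_tail {N : ℕ} {A : Fin N → Item m u} (hw : ∀ n, 0 < (A n).weight) {t₀ δ : ℝ}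
    (ht : 0 < t₀) (hδ : 0 < δ) (hδ1 : δ ≤ 1) (hy : 2 ≤ δ ^ 2 * (totalWeight A / t₀)) :
    (uniformLaw N).real (⋃ i : ℕ, badAt A δ (t₀ / (1 + δ) ^ i))
      ≤ 80 / δ ^ 2 * Real.exp (-(δ ^ 2 * (totalWeight A / t₀) / 8)) := by
  set y := δ ^ 2 * (totalWeight A / t₀) with hydef
  set q := Real.exp (-(y * δ / 8)) with hq
  have hq0 : 0 ≤ q := (Real.exp_pos _).le
  have hyδ : 0 < y * δ := by positivity
  have hq1 : q < 1 := Real.exp_lt_one_iff.2 (by linarith)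
  have hterm : ∀ i : ℕ, (uniformLaw N).real (badAt A δ (t₀ / (1 + δ) ^ i))
      ≤ 16 / δ * Real.exp (-(y / 8)) * q ^ i := by
    intro i
    -- Bernoulli's inequality turns the doubly exponential decay into a geometric series of ratio
    -- `q`.
    have hp : 1 + i * δ ≤ (1 + δ) ^ i := one_add_mul_le_pow (by linarith) i
    have e1 : δ ^ 2 * (totalWeight A / (t₀ / (1 + δ) ^ i)) = y * (1 + δ) ^ i := by
      rw [hydef]; field_simp
    have e2 : y * (1 + i * δ) ≤ y * (1 + δ) ^ i := by gcongr
    have e3 : 0 ≤ y * (i * δ) := by positivity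
    have := badAt_tail hw (t := t₀ / (1 + δ) ^ i) (by positivity) hδ hδ1 (by rw [e1]; linarith)
    rw [e1] at this
    refine this.trans ?_
    rw [hq, ← Real.exp_nat_mul, mul_assoc (16 / δ), ← Real.exp_add]
    refine mul_le_mul_of_nonneg_left (Real.exp_le_exp.2 ?_) (by positivity)
    linarith
  have hsum : HasSum (fun i : ℕ => 16 / δ * Real.exp (-(y / 8)) * q ^ i)
      (16 / δ * Real.exp (-(y / 8)) * (1 - q)⁻¹) :=
    (hasSum_geometric_of_lt_one hq0 hq1).mul_left _
  have h1 : (uniformLaw N).real (⋃ i : ℕ, badAt A δ (t₀ / (1 + δ) ^ i))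
      ≤ 16 / δ * Real.exp (-(y / 8)) * (1 - q)⁻¹ := by
    refine ENNReal.toReal_le_of_le_ofReal ?_ ((measure_iUnion_le _).trans ?_)
    · have : 0 ≤ (1 - q)⁻¹ := inv_nonneg.2 (by linarith)
      positivity
    · rw [← hsum.tsum_eq, ENNReal.ofReal_tsum_of_nonneg (fun i => by positivity) hsum.summable]
      refine ENNReal.tsum_le_tsum fun i => ?_
      rw [← ofReal_measureReal]
      exact ENNReal.ofReal_le_ofReal (hterm i)
  refine h1.trans ?_
  -- From `2 ≤ y`, `q * (1 + δ / 4) ≤ 1`; with `δ ≤ 1` this gives `1 - q ≥ δ / 5`.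
  have h2 : (1 - q)⁻¹ ≤ 5 / δ := by
    rw [inv_le_comm₀ (by linarith) (by positivity), inv_div]
    have e1 : q * Real.exp (y * δ / 8) = 1 := by rw [hq, ← Real.exp_add]; simp
    have e2 := Real.add_one_le_exp (y * δ / 8)
    have e3 : q * (1 + δ / 4) ≤ 1 := by
      rw [← e1]
      refine mul_le_mul_of_nonneg_left ?_ hq0
      nlinarith
    nlinarith
  calc 16 / δ * Real.exp (-(y / 8)) * (1 - q)⁻¹
      ≤ 16 / δ * Real.exp (-(y / 8)) * (5 / δ) := by gcongr
    _ = 80 / δ ^ 2 * Real.exp (-(y / 8)) := by field_simp; ring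

/-! ### Accuracy for all labels -/

lemma failure_le {s : ℕ} {ε : ℝ} (hs : 1 ≤ s) (hε : 0 < ε) (hε2 : ε ≤ 1 / 2)
    (h : 138240 * (1 / ε ^ 2 * Real.log (1 / ε)) ≤ s) :
    Real.exp (-2 * s) + 80 / (ε / 3) ^ 2 * Real.exp (-((ε / 3) ^ 2 * (s / 32) / 8)) ≤ 1 / s := by
  have hs' : (1 : ℝ) ≤ s := by exact_mod_cast hs
  set z := ε ^ 2 * s with hz
  have hzL : 138240 * Real.log (1 / ε) ≤ z := by
    have := mul_le_mul_of_nonneg_left h (sq_nonneg ε)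
    refine le_trans (le_of_eq ?_) this
    field_simp
  have hse : (s : ℝ) = z / ε ^ 2 := by rw [hz]; field_simp
  have h1 : Real.exp (-2 * s) * s ≤ 1 / 2 := by
    have e1 := Real.add_one_le_exp (s : ℝ)
    have e2 : Real.exp (-2 * s) = Real.exp (-s) * Real.exp (-s) := by
      rw [← Real.exp_add]; ring_nf
    have e3 : Real.exp (-(s : ℝ)) * Real.exp s = 1 := by rw [← Real.exp_add]; simp
    have e4 := Real.exp_pos (-(s : ℝ))
    have e5 : Real.exp (-(s : ℝ)) * s ≤ 1 := by nlinarith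
    have e6 : Real.exp (-(s : ℝ)) ≤ 1 / 2 := by nlinarith
    rw [e2]
    nlinarith
  have h2 : 80 / (ε / 3) ^ 2 * Real.exp (-((ε / 3) ^ 2 * (s / 32) / 8)) * s ≤ 1 / 2 := by
    -- The exponent is `z / 2304`. One half of it absorbs the factor `z`; the other yields `ε ^ 30`,
    -- as `138240 = 30 * 4608`, which beats `1 / ε ^ 4`.
    have e1 : Real.exp (-((ε / 3) ^ 2 * (s / 32) / 8))
        = Real.exp (-(z / 4608)) * Real.exp (-(z / 4608)) := by
      rw [← Real.exp_add, hz]; ring_nf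
    have e2 := Real.add_one_le_exp (z / 4608)
    have e3 : Real.exp (-(z / 4608)) * Real.exp (z / 4608) = 1 := by rw [← Real.exp_add]; simp
    have e4 : Real.exp (-(z / 4608)) * z ≤ 4608 := by nlinarith [Real.exp_pos (-(z / 4608))]
    have e5 : Real.exp (-(z / 4608)) ≤ ε ^ 30 := by
      rw [← Real.exp_log (pow_pos hε 30), Real.exp_le_exp, Real.log_pow]
      rw [one_div, Real.log_inv] at hzL
      push_cast
      linarith
    have e6 : ε ^ 26 ≤ (1 / 2) ^ 26 := pow_le_pow_left₀ hε.le hε2 26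
    calc 80 / (ε / 3) ^ 2 * Real.exp (-((ε / 3) ^ 2 * (s / 32) / 8)) * s
        = 720 / ε ^ 4 * ((Real.exp (-(z / 4608)) * z) * Real.exp (-(z / 4608))) := by
          rw [e1, hse]; field_simp; ring
      _ ≤ 720 / ε ^ 4 * (4608 * ε ^ 30) := by gcongr
      _ = 720 * 4608 * ε ^ 26 := by field_simp
      _ ≤ 720 * 4608 * (1 / 2) ^ 26 := by gcongr
      _ ≤ 1 / 2 := by norm_num
  rw [le_div_iff₀ (by linarith), add_mul]
  linarith

lemma accuracy {N : ℕ} (A : Fin N → Item m u) (hA : ∀ n, 1 ≤ (A n).weight) {s : ℕ}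
    (hs : 1 ≤ s) {ε : ℝ} (hε : 0 < ε) (hε2 : ε ≤ 1 / 2)
    (h : 138240 * (1 / ε ^ 2 * Real.log (1 / ε)) ≤ s) (hsN : s ≤ N) :
    1 - 1 / (s : ℝ) ≤ (uniformLaw N).real
      {r | ∀ e : Fin u, |(run s A r).estimate e - freq A e| ≤ ε * totalWeight A} := by
  have hw : ∀ n, 0 < (A n).weight := fun n => by linarith [hA n]
  have hs' : (1 : ℝ) ≤ s := by exact_mod_cast hs
  have hW : 0 < totalWeight A := by
    have : Nonempty (Fin N) := ⟨⟨0, by omega⟩⟩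
    exact Finset.sum_pos (fun n _ => hw n) Finset.univ_nonempty
  set t₀ := 32 * totalWeight A / s with ht₀
  have ht₀pos : 0 < t₀ := by positivity
  have hratio : totalWeight A / t₀ = s / 32 := by rw [ht₀]; field_simp
  -- `576 = 2 * 9 * 32` is what the hypothesis `2 ≤ δ ^ 2 * (W / t₀)` of `grid_tail` needs for `δ =
  -- ε / 3` and `W / t₀ = s / 32`.
  have hbig : 576 / ε ^ 2 ≤ s := by
    have hl : Real.log 2 ≤ Real.log (1 / ε) :=
      Real.log_le_log (by norm_num) ((le_div_iff₀ hε).2 (by linarith))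
    have hl2 := Real.log_two_gt_d9
    refine le_trans ?_ h
    rw [div_eq_mul_one_div, ← mul_assoc, mul_comm 138240, mul_assoc, mul_comm (576 : ℝ)]
    refine mul_le_mul_of_nonneg_left ?_ (by positivity)
    linarith
  have hy : 2 ≤ (ε / 3) ^ 2 * (totalWeight A / t₀) := by
    rw [hratio]
    rw [div_le_iff₀ (by positivity)] at hbig
    linarith
  have p1 := many_hits_tail hw (s := s) ht₀pos
    (by rw [ht₀]; exact le_of_eq (by rw [totalWeight]; field_simp))
  have p2 := grid_tail hw ht₀pos (δ := ε / 3) (by positivity) (by linarith) hy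
  rw [hratio] at p2
  refine one_sub_le_real ?_ (((measureReal_union_le _ _).trans (add_le_add p1 p2)).trans
    (failure_le hs hε hε2 h))
  filter_upwards [ae_generic A hA] with r hr hB
  simp only [Set.mem_union, Set.mem_ofPred_eq, hits_univ, Nat.cast_le, not_or, not_le,
    Set.mem_iUnion, not_exists] at hB ⊢
  have hlen := min_le_length_held hs A r hr hA
  rw [min_eq_left hsN] at hlen
  have hne : (run s A r).held ≠ [] := by
    rintro h0
    rw [h0] at hlen
    simp at hlen
    omega
  obtain ⟨k1, k2, k3⟩ := estimate_run hs A r hr hne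
  -- Otherwise all held items, at least `s` of them, would have priority above `t₀`.
  have hle : (run s A r).minPriority ≤ t₀ := by
    by_contra! hlt
    exact absurd (hlen.trans (k2 _ hlt)) (not_le.2 hB.1)
  intro e
  rw [k3]
  refine (abs_estimateAt_sub_le hw (fun n => ⟨hr.pos n, hr.lt_one n⟩) (by positivity)
    (by linarith) hB.2 k1 hle e).trans_eq (by ring)

end PrioritySampling

end

theorem theorem2 :
    ∃ C c K : ℝ, 0 < C ∧ 0 < c ∧ 0 < K ∧
      ∀ (m u s N : ℕ) (β : ℝ) (A : Fin N → PrioritySampling.Item m u),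
        1 ≤ s → 1 ≤ β → (∀ n, 1 ≤ (A n).weight ∧ (A n).weight ≤ β) →
        -- number of rounds and number of messages
        (2 * (s : ℝ) ≤ β * N →
          1 - Real.exp (-c * s) ≤ (PrioritySampling.uniformLaw N).real
            {r | ((PrioritySampling.run s A r).round : ℝ) + 1 ≤ C * Real.log (β * N / s)} ∧
          1 - Real.exp (-c * s) ≤ (PrioritySampling.uniformLaw N).real
            {r | ((PrioritySampling.run s A r).messages : ℝ)
                  ≤ C * (((m : ℝ) + s) * Real.log (β * N / s))}) ∧
        -- size of the sample
        (∀ᵐ r ∂(PrioritySampling.uniformLaw N),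
          min s N ≤ (PrioritySampling.run s A r).held.length ∧
          (PrioritySampling.run s A r).sample.length
            = (PrioritySampling.run s A r).held.length - 1) ∧
        1 - Real.exp (-c * s) ≤ (PrioritySampling.uniformLaw N).real
          {r | ((PrioritySampling.run s A r).held.length : ℝ) ≤ C * s} ∧
        -- accuracy of the estimates, for all elements at once
        (∀ ε : ℝ, 0 < ε → ε ≤ 1 / 2 → K * (1 / ε ^ 2 * Real.log (1 / ε)) ≤ s → s ≤ N →
          1 - 1 / (s : ℝ) ≤ (PrioritySampling.uniformLaw N).real
            {r | ∀ e : Fin u,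
              |(PrioritySampling.run s A r).estimate e - PrioritySampling.freq A e|
                ≤ ε * PrioritySampling.totalWeight A}) := by
  -- `100` covers the constants `12` for rounds, `100` for messages and `32` for the sample size.
  refine ⟨100, 1, 138240, by norm_num, by norm_num, by norm_num, ?_⟩
  intro m u s N β A hs _ hA
  have hA1 : ∀ n, 1 ≤ (A n).weight := fun n => (hA n).1
  refine ⟨fun h => ⟨?_, PrioritySampling.messages_tail A hA hs h⟩, ?_, ?_, ?_⟩
  · refine (PrioritySampling.rounds_tail A hA hs h).trans
      (measureReal_mono (fun r hr => ?_) (measure_ne_top _ _))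
    have hs' : (0 : ℝ) < s := by exact_mod_cast hs
    have hlog : 0 ≤ Real.log (β * N / s) :=
      Real.log_nonneg ((one_le_div hs').2 (by linarith))
    simp only [Set.mem_ofPred_eq] at hr ⊢
    linarith
  · filter_upwards [PrioritySampling.ae_generic A hA1] with r hr
    exact ⟨PrioritySampling.min_le_length_held hs A r hr hA1, PrioritySampling.length_sample _⟩
  · refine (PrioritySampling.held_tail A hA1 hs).trans
      (measureReal_mono (fun r hr => ?_) (measure_ne_top _ _))
    have hs' : (0 : ℝ) ≤ s := by positivity
    simp only [Set.mem_ofPred_eq] at hr ⊢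
    linarith
  · intro ε hε hε2 h hsN
    exact PrioritySampling.accuracy A hA1 hs hε hε2 h hsN
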